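/- For even integers $m\ge 4$ and $n\ge 6$, an odd $k\in\mathbb{Z}_n$ and an even $\ell\in\mathbb{Z}_n$, let $\mathcal{X}_a(m,n,k,\ell)$ be the graph with vertices $u_{i,j}$, $i\in\mathbb{Z}_m$, $j\in\mathbb{Z}_n$, and the following edges. The links are $u_{i,j}\sim u_{i+1,j}$ for $0\le i\le m-2$ and $j\equiv i \pmod 2$, and $u_{m-1,j}\sim u_{0,j+\ell}$ for $j$ odd. The non-links are $u_{i,j}\sim u_{i,j\pm 1}$ for $i$ even and $u_{i,j}\sim u_{i,j\pm k}$ for $i$ odd. The code of a $10$-cycle $(v_0,\dots,v_9)$ is the sequence $c_0\cdots c_9$, up to rotation and reflection, where $c_t=0$ if $v_tv_{t+1}$ is a link and $c_t=1$ otherwise (indices modulo $10$); the cycle is of type $2$ if its code is $1^6 0 1^2 0$ and of type $3$ if its code is $1^3 0101010$. Let $\Gamma=\mathcal{X}_a(m,n,k,\ell)$, where $m\ge 4$ and $n=2n'\geq 14$ are even, $\ell\in\mathbb{Z}_n$ is even, $k\in\mathbb{Z}_n$ is odd, and the following hold in $\mathbb{Z}_n$: $2k\ne\pm 2$, $2k^2=\pm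 2$, and either - $\ell k=\pm\ell$, and $k^2=\pm1$ or $4\mid m$; or - $\ell k=n'\pm\ell$, $m\equiv 2\pmod 4$ and $k^2=n'\pm 1$. (In each case all choices of signs are independent.) Suppose moreover that $4k=4$ in $\mathbb{Z}_n$ and that $\Gamma$ has no $10$-cycles of types $2$ and $3$. If $\Gamma$ admits an automorphism that fixes the vertex $u_{0,0}$ and cyclically permutes its three neighbours, then there are $k',\ell'\in\mathbb{Z}_n$, obtained from $k,\ell$ by a finite (possibly empty) sequence of the changes $$(k,\ell)\mapsto(-k,\ell),\qquad (k,\ell)\mapsto(k,-\ell),$$ and, if $4\mid n$, $(k,\ell)\mapsto(k+n',\ell)$ when $4\mid m$, respectively $(k,\ell)\mapsto(k+n',\ell+n')$ when $4\nmid m$, such that $\Gamma\cong\mathcal{X}_a(m,n,k',\ell')$, and there are odd integers $m_0\ge 3$, $n_0\ge 1$ and an even integer $\ell_0$ with $0\le \ell_0<4n_0$ such that $$4\mid \ell_0+m_0n_0-1,\qquad n_0\mid \ell_0^2+3,\qquad m=2m_0,\quad n=4n_0m,\quad k'=n_0m+1,\quad \ell'=\ell_0m,$$ the last two equalities being in $\mathbb{Z}_n$.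 -/

import Mathlib

namespace AltQuotient

/-- The vertex `u_{i,j}` is the pair `(i, j)`. -/
abbrev Vert (m n : ℕ) : Type := ZMod m × ZMod n

/-- The oriented links: for `j ≡ i (mod 2)` the vertex `u_{i,j}` is joined to `u_{i+1,j}` when
`i ≠ m - 1`, and to `u_{0,j+ℓ}` when `i = m - 1`. (Representatives are in `[0,m)` and `[0,n)`.) -/
def UpLink (m n : ℕ) (ℓ : ZMod n) (p q : Vert m n) : Prop :=
  p.2.val % 2 = p.1.val % 2 ∧ q.1 = p.1 + 1 ∧
    q.2 = p.2 + (if p.1.val + 1 = m then ℓ else 0)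

/-- The pair `p, q` is a link (an edge joining two different cycles `C_i`). -/
def IsLink (m n : ℕ) (ℓ : ZMod n) (p q : Vert m n) : Prop :=
  UpLink m n ℓ p q ∨ UpLink m n ℓ q p

/-- The step of the cycle `C_i`: it is `1` for `i` even and `k` for `i` odd. -/
def step (m n : ℕ) (k : ZMod n) (i : ZMod m) : ZMod n :=
  if i.val % 2 = 0 then 1 else k

/-- The pair `p, q` is a non-link (an edge of one of the cycles `C_i`):
`u_{i,j}` is joined to `u_{i,j±1}` for `i` even and to `u_{i,j±k}` for `i` odd. -/
def IsNonLink (m n : ℕ) (k : ZMod n) (p q : Vert m n) : Prop :=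
  q.1 = p.1 ∧ (q.2 = p.2 + step m n k p.1 ∨ q.2 = p.2 - step m n k p.1)

/-- The graph `X_a(m,n,k,ℓ)`. -/
def Xa (m n : ℕ) (k ℓ : ZMod n) : SimpleGraph (Vert m n) :=
  SimpleGraph.fromRel (fun p q => IsLink m n ℓ p q ∨ IsNonLink m n k p q)

/-- The vertex-transitivity conditions on the parameters: `m ≥ 4` and `n` are even, `ℓ` is even,
`k` is odd, `2k ≠ ±2`, `2k² = ±2`, and one of the two stated alternatives holds. -/
structure Admissible (m n : ℕ) (k ℓ : ZMod n) : Prop where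
  four_le : 4 ≤ m
  even_m : Even m
  even_n : Even n
  even_l : Even ℓ
  odd_k : Odd k
  two_k : 2 * k ≠ 2 ∧ 2 * k ≠ -2
  two_k_sq : 2 * k ^ 2 = 2 ∨ 2 * k ^ 2 = -2
  cond :
    ((ℓ * k = ℓ ∨ ℓ * k = -ℓ) ∧ ((k ^ 2 = 1 ∨ k ^ 2 = -1) ∨ 4 ∣ m)) ∨
    ((ℓ * k = ((n / 2 : ℕ) : ZMod n) + ℓ ∨ ℓ * k = ((n / 2 : ℕ) : ZMod n) - ℓ) ∧ m % 4 = 2 ∧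
      (k ^ 2 = ((n / 2 : ℕ) : ZMod n) + 1 ∨ k ^ 2 = ((n / 2 : ℕ) : ZMod n) - 1))

/-- There is a `10`-cycle `(c 0, …, c 9)` of `X_a(m,n,k,ℓ)` whose code is `code`: the edge from
`c t` to `c (t+1)` (indices modulo `10`) is a link exactly when `code t = 0`. -/
def HasTenCycle (m n : ℕ) (k ℓ : ZMod n) (code : Fin 10 → ℕ) : Prop :=
  ∃ c : Fin 10 → Vert m n, Function.Injective c ∧
    ∀ t : Fin 10, (Xa m n k ℓ).Adj (c t) (c (t + 1)) ∧
      (IsLink m n ℓ (c t) (c (t + 1)) ↔ code t = 0)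

/-- Type `2`: the code is `1⁶ 0 1² 0`. -/
def HasTenCycleType2 (m n : ℕ) (k ℓ : ZMod n) : Prop :=
  HasTenCycle m n k ℓ ![1, 1, 1, 1, 1, 1, 0, 1, 1, 0]

/-- Type `3`: the code is `1³ 0101010`. -/
def HasTenCycleType3 (m n : ℕ) (k ℓ : ZMod n) : Prop :=
  HasTenCycle m n k ℓ ![1, 1, 1, 0, 1, 0, 1, 0, 1, 0]

/-- The automorphism `η` fixes the vertex `v`, and it permutes its neighbours, which are
three in number, in a `3`-cycle. -/
def RotatesAt {V : Type*} (G : SimpleGraph V) (η : G ≃g G) (v : V) : Prop :=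
  η v = v ∧ ∃ a b c : V, a ≠ b ∧ b ≠ c ∧ a ≠ c ∧ G.neighborSet v = {a, b, c} ∧
    η a = b ∧ η b = c ∧ η c = a

/-- The basic changes of the pair `(k, ℓ)`: to `(-k, ℓ)`, to `(k, -ℓ)`, and, with `n = 2n'` and
`4 ∣ n`, to `(k + n', ℓ)` if `4 ∣ m` and to `(k + n', ℓ + n')` if not. -/
inductive Move (m n : ℕ) : ZMod n × ZMod n → ZMod n × ZMod n → Prop
  | neg_k (k ℓ : ZMod n) : Move m n (k, ℓ) (-k, ℓ)
  | neg_l (k ℓ : ZMod n) : Move m n (k, ℓ) (k, -ℓ)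
  | shift_k (k ℓ : ZMod n) (hn : 4 ∣ n) (hm : 4 ∣ m) :
      Move m n (k, ℓ) (k + ((n / 2 : ℕ) : ZMod n), ℓ)
  | shift_both (k ℓ : ZMod n) (hn : 4 ∣ n) (hm : ¬ 4 ∣ m) :
      Move m n (k, ℓ) (k + ((n / 2 : ℕ) : ZMod n), ℓ + ((n / 2 : ℕ) : ZMod n))

end AltQuotient

open AltQuotient

/-! The graph is a quotient of a cubic graph on `ℤ × ℤ` by translations with even coordinates. The
links and the two alternating classes of non-links give a proper 3-edge-colouring. The conditions
`4k = 4` and `2k ≠ 2` give `n = 4N` and `K = 1 + N * E` with `E` odd. For the short words needed,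
closing up is then decided by a symbolic displacement. The exceptions are a coincidence at `n = 16`
and words that wrap around when `m = 4`; the absence of cycles of types 2 and 3 excludes them.

The 10-cycles see the colouring: a path of three edges fails the purely graph-theoretic property
`Cis` exactly when its outer edges have equal colours (`cis_iff`). So an automorphism acts along
every walk by one permutation of the colours (`map_walk`), and a rotation at `u_{0,0}` makes the set
of closed colour words there invariant under `c ↦ c + 1` (`walk_rotate`).

Rotating two explicit closed words yields `n = 4n₀m`, `m₀(1 + K) + L = 2mp` with `p` odd, and `4n₀ ∣
2p(1 - p) - (1 + K)` (`exists_parameters`). Parity makes `m₀` and `n₀` odd, and `n₀ ∣ p² - p + 1`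
says that `(2p - 1)² ≡ -3`. Finally `E` is 1 or 3, and `nonempty_iso_shift` reduces the second case
to the required form. -/

namespace AltQuotient

/-! ### The coloured lattice and its quotient. -/

/-- Parity and size conditions under which `X_a(m,n,K,L)` is a quotient of a graph on `ℤ × ℤ`. -/
structure LatticeData (m n : ℕ) (K L : ℤ) : Prop where
  four_le : 4 ≤ m
  n_pos : 0 < n
  even_m : (m : ℤ) % 2 = 0
  even_n : (n : ℤ) % 2 = 0
  odd_K : K % 2 = 1
  even_L : L % 2 = 0

/-- The colour of a lattice point: `1` if its coordinates have the same parity, `-1` if not. -/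
def sgn (p : ℤ × ℤ) : ℤ := if (p.1 + p.2) % 2 = 0 then 1 else -1

/-- The step in layer `x` of the lattice. -/
def hstep (K x : ℤ) : ℤ := if x % 2 = 0 then 1 else K

/-- The neighbour of a lattice point along the edge of colour `c`; the links have colour `2`. -/
def act (K : ℤ) (c : Fin 3) (p : ℤ × ℤ) : ℤ × ℤ :=
  if c = 2 then (p.1 + sgn p, p.2)
  else (p.1, p.2 + sgn p * (if c = 0 then 1 else -1) * hstep K p.1)

/-- The covering projection from the lattice to the vertex set. -/
def proj (m n : ℕ) (L : ℤ) (p : ℤ × ℤ) : Vert m n :=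
  ((p.1 : ZMod m), ((p.2 + p.1 / m * L : ℤ) : ZMod n))

variable {m n : ℕ} {K L : ℤ}

theorem sgn_eq (p : ℤ × ℤ) :
    ((p.1 + p.2) % 2 = 0 ∧ sgn p = 1) ∨ ((p.1 + p.2) % 2 = 1 ∧ sgn p = -1) := by
  unfold sgn; split_ifs with h
  · exact .inl ⟨h, rfl⟩
  · exact .inr ⟨by omega, rfl⟩

theorem hstep_odd (hK : K % 2 = 1) (x : ℤ) : hstep K x % 2 = 1 := by
  unfold hstep; split_ifs <;> omega

theorem sgn_add (p d : ℤ × ℤ) (h1 : d.1 % 2 = 0) (h2 : d.2 % 2 = 0) :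
    sgn (p + d) = sgn p := by
  unfold sgn
  have : (p + d).1 + (p + d).2 = p.1 + p.2 + (d.1 + d.2) := by simp; ring
  rw [this]
  congr 1
  apply propext; constructor <;> intro <;> omega

theorem act_add (c : Fin 3) (p d : ℤ × ℤ) (h1 : d.1 % 2 = 0) (h2 : d.2 % 2 = 0) :
    act K c (p + d) = act K c p + d := by
  have hs : hstep K (p.1 + d.1) = hstep K p.1 := by
    unfold hstep; congr 1; apply propext; constructor <;> intro <;> omega
  unfold act
  rw [sgn_add p d h1 h2]
  split_ifs <;> ext <;> simp [hs] <;> ring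

/-- Every edge changes the coordinate sum by an odd number. This is what makes each `act K c` an
involution. -/
theorem sgn_act (hK : K % 2 = 1) (c : Fin 3) (p : ℤ × ℤ) : sgn (act K c p) = - sgn p := by
  have h := hstep_odd hK p.1
  have key : (act K c p).1 + (act K c p).2 = p.1 + p.2 + 1 ∨
      (act K c p).1 + (act K c p).2 = p.1 + p.2 - 1 ∨
      (act K c p).1 + (act K c p).2 = p.1 + p.2 + hstep K p.1 ∨
      (act K c p).1 + (act K c p).2 = p.1 + p.2 - hstep K p.1 := by
    unfold act
    rcases sgn_eq p with ⟨_, hs⟩ | ⟨_, hs⟩ <;> rw [hs] <;> split_ifs <;> simp <;> omega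
  rcases sgn_eq p with ⟨h1, hs⟩ | ⟨h1, hs⟩ <;>
    rcases sgn_eq (act K c p) with ⟨h2, hs'⟩ | ⟨h2, hs'⟩ <;> rw [hs, hs'] <;> omega

theorem act_act (hK : K % 2 = 1) (c : Fin 3) (p : ℤ × ℤ) : act K c (act K c p) = p := by
  have h := sgn_act hK c p
  by_cases hc : c = 2
  · have e : act K c p = (p.1 + sgn p, p.2) := by simp [act, hc]
    rw [act, if_pos hc, h, e]; ext <;> simp
  · have e : act K c p = (p.1, p.2 + sgn p * (if c = 0 then 1 else -1) * hstep K p.1) := by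
      simp [act, hc]
    rw [act, if_neg hc, h, e]
    ext
    · simp
    · simp only; ring

/-- The fibres are orbits of the translations generated by `(m, -L)` and `(0, n)`; `t` counts turns
around the layers. These vectors have even coordinates, so colours descend to the quotient. -/
theorem proj_eq_iff (hd : LatticeData m n K L) (p q : ℤ × ℤ) :
    proj m n L p = proj m n L q ↔
      ∃ t : ℤ, q.1 = p.1 + t * m ∧ (n : ℤ) ∣ q.2 - p.2 + t * L := by
  have hm : (m : ℤ) ≠ 0 := by have := hd.four_le; omega
  unfold proj
  rw [Prod.mk.injEq, ZMod.intCast_eq_intCast_iff_dvd_sub, ZMod.intCast_eq_intCast_iff_dvd_sub]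
  constructor
  · rintro ⟨⟨t, ht⟩, h2⟩
    have e : q.1 = p.1 + t * m := by linarith
    refine ⟨t, e, ?_⟩
    rw [e, Int.add_mul_ediv_right _ _ hm] at h2
    convert h2 using 1; ring
  · rintro ⟨t, e, h2⟩
    refine ⟨⟨t, by rw [e]; ring⟩, ?_⟩
    rw [e, Int.add_mul_ediv_right _ _ hm]
    convert h2 using 1; ring

theorem proj_act (hd : LatticeData m n K L) (c : Fin 3) {p q : ℤ × ℤ}
    (h : proj m n L p = proj m n L q) :
    proj m n L (act K c p) = proj m n L (act K c q) := by
  obtain ⟨t, h1, u, h2⟩ := (proj_eq_iff hd p q).1 h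
  have e : q = p + (t * m, n * u - t * L) := by
    ext
    · simp [h1]
    · simp; linarith
  have em : (t * (m : ℤ)) % 2 = 0 := by rw [Int.mul_emod, hd.even_m]; simp
  have en : ((n : ℤ) * u - t * L) % 2 = 0 := by
    rw [Int.sub_emod, Int.mul_emod, hd.even_n, Int.mul_emod t, hd.even_L]; simp
  rw [e, act_add c p _ em en]
  exact (proj_eq_iff hd _ _).2 ⟨t, by simp, ⟨u, by simp⟩⟩

theorem proj_val (hd : LatticeData m n K L) (v : Vert m n) :
    proj m n L ((v.1.val : ℤ), (v.2.val : ℤ)) = v := by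
  have : NeZero m := ⟨by have := hd.four_le; omega⟩
  have : NeZero n := ⟨by have := hd.n_pos; omega⟩
  have h : ((v.1.val : ℤ) / (m : ℤ)) = 0 :=
    Int.ediv_eq_zero_of_lt (by positivity) (by exact_mod_cast ZMod.val_lt v.1)
  refine Prod.ext (by simp [proj]) ?_
  change (((v.2.val : ℤ) + (v.1.val : ℤ) / (m : ℤ) * L : ℤ) : ZMod n) = v.2
  rw [h]; simp

theorem proj_surjective (hd : LatticeData m n K L) : Function.Surjective (proj m n L) :=
  fun v => ⟨_, proj_val hd v⟩

/-- The neighbour of a vertex along the edge of colour `c`. -/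
def nb (m n : ℕ) (K L : ℤ) (c : Fin 3) (v : Vert m n) : Vert m n :=
  proj m n L (act K c ((v.1.val : ℤ), (v.2.val : ℤ)))

theorem nb_proj (hd : LatticeData m n K L) (c : Fin 3) (p : ℤ × ℤ) :
    nb m n K L c (proj m n L p) = proj m n L (act K c p) :=
  proj_act hd c (proj_val hd _)

theorem nb_nb (hd : LatticeData m n K L) (c : Fin 3) (v : Vert m n) :
    nb m n K L c (nb m n K L c v) = v := by
  obtain ⟨p, rfl⟩ := proj_surjective hd v
  rw [nb_proj hd, nb_proj hd, act_act hd.odd_K]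

theorem proj_fst_val (hd : LatticeData m n K L) (p : ℤ × ℤ) :
    (((proj m n L p).1.val : ℕ) : ℤ) = p.1 % m := by
  have : NeZero m := ⟨by have := hd.four_le; omega⟩
  exact ZMod.val_intCast _

theorem val_mod_two {N : ℕ} (h0 : 0 < N) (hN : (N : ℤ) % 2 = 0) (a : ℤ) :
    (((a : ZMod N).val : ℕ) : ℤ) % 2 = a % 2 := by
  have : NeZero N := ⟨by omega⟩
  rw [ZMod.val_intCast]
  exact Int.emod_emod_of_dvd a (by omega)

theorem proj_fst_mod_two (hd : LatticeData m n K L) (p : ℤ × ℤ) :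
    (((proj m n L p).1.val : ℕ) : ℤ) % 2 = p.1 % 2 :=
  val_mod_two (by have := hd.four_le; omega) hd.even_m _

theorem proj_snd_mod_two (hd : LatticeData m n K L) (p : ℤ × ℤ) :
    (((proj m n L p).2.val : ℕ) : ℤ) % 2 = p.2 % 2 := by
  refine (val_mod_two hd.n_pos hd.even_n _).trans ?_
  rw [Int.add_emod, Int.mul_emod, hd.even_L]; simp

/-- The quotient `p.1 / m` used in `proj` jumps by one exactly on leaving layer `m - 1`, which
reproduces the twist by `ℓ`. -/
theorem upLink_proj (hd : LatticeData m n K L) (p : ℤ × ℤ) (v : Vert m n) :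
    UpLink m n L (proj m n L p) v ↔ (p.1 + p.2) % 2 = 0 ∧ v = proj m n L (p.1 + 1, p.2) := by
  have hm := hd.four_le
  have a1 := proj_fst_mod_two hd p
  have a2 := proj_snd_mod_two hd p
  have a3 := proj_fst_val hd p
  have e : (proj m n L p).2 + (if (proj m n L p).1.val + 1 = m then (L : ZMod n) else 0) =
      (proj m n L (p.1 + 1, p.2)).2 := by
    have key : (p.1 + 1) / (m : ℤ) =
        p.1 / m + (if (proj m n L p).1.val + 1 = m then 1 else 0) := by
      have h0 := Int.emod_add_mul_ediv p.1 m
      have h1 := Int.emod_nonneg p.1 (show (m : ℤ) ≠ 0 by omega)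
      have h2 := Int.emod_lt_of_pos p.1 (show (0 : ℤ) < m by omega)
      split_ifs with h
      · rw [show p.1 + 1 = 0 + (p.1 / m + 1) * m by
          have : p.1 % m + 1 = m := by omega
          linarith, Int.add_mul_ediv_right _ _ (by omega)]
        simp
      · rw [show p.1 + 1 = (p.1 % m + 1) + (p.1 / m) * m by linarith,
          Int.add_mul_ediv_right _ _ (by omega),
          Int.ediv_eq_zero_of_lt (by omega) (by omega)]
        simp
    change ((p.2 + p.1 / m * L : ℤ) : ZMod n) + _ = ((p.2 + (p.1 + 1) / m * L : ℤ) : ZMod n)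
    rw [key]
    split_ifs <;> push_cast <;> ring
  unfold UpLink
  rw [e]
  constructor
  · rintro ⟨h1, h2, h3⟩
    refine ⟨by omega, Prod.ext ?_ h3⟩
    rw [h2]; simp [proj]
  · rintro ⟨h1, rfl⟩
    exact ⟨by omega, by simp [proj], rfl⟩

theorem isLink_proj (hd : LatticeData m n K L) (p : ℤ × ℤ) (v : Vert m n) :
    IsLink m n L (proj m n L p) v ↔ v = proj m n L (act K 2 p) := by
  obtain ⟨q, rfl⟩ := proj_surjective hd v
  have e2 : act K 2 p = (p.1 + sgn p, p.2) := by simp [act]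
  have aux : ∀ a b : ℤ × ℤ, (a.1 + a.2) % 2 = 0 ∧ proj m n L b = proj m n L (a.1 + 1, a.2) →
      proj m n L b = proj m n L (act K 2 a) := by
    rintro a b ⟨h, e⟩
    rw [e]; simp [act, sgn, h]
  unfold IsLink
  rw [upLink_proj hd, upLink_proj hd]
  constructor
  · rintro (h | h)
    · exact aux _ _ h
    · have := proj_act hd 2 (aux _ _ h)
      rw [act_act hd.odd_K] at this
      exact this.symm
  · intro h
    rcases sgn_eq p with ⟨h1, hs⟩ | ⟨h1, hs⟩
    · left; refine ⟨h1, ?_⟩; rw [h, e2, hs]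
    · right
      rw [e2, hs] at h
      obtain ⟨t, ht, u, hu⟩ := (proj_eq_iff hd _ _).1 h.symm
      refine ⟨?_, ?_⟩
      · have em : (t * (m : ℤ)) % 2 = 0 := by rw [Int.mul_emod, hd.even_m]; simp
        have en : ((n : ℤ) * u - t * L) % 2 = 0 := by
          rw [Int.sub_emod, Int.mul_emod, hd.even_n, Int.mul_emod t, hd.even_L]; simp
        have e1 : q.2 = p.2 + (n * u - t * L) := by simp at hu; linarith
        simp only at ht
        omega
      · rw [proj_eq_iff hd]
        exact ⟨t, by simp only at ht ⊢; linarith, u, by simpa using hu⟩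

theorem isNonLink_proj (hd : LatticeData m n K L) (p : ℤ × ℤ) (v : Vert m n) :
    IsNonLink m n K (proj m n L p) v ↔
      ∃ c : Fin 3, c ≠ 2 ∧ v = proj m n L (act K c p) := by
  have a1 := proj_fst_mod_two hd p
  have hs : step m n (K : ZMod n) (proj m n L p).1 = ((hstep K p.1 : ℤ) : ZMod n) := by
    unfold step hstep
    by_cases h : p.1 % 2 = 0
    · rw [if_pos h, if_pos (by omega)]; simp
    · rw [if_neg h, if_neg (by omega)]
  have e : ∀ δ : ℤ, proj m n L (p.1, p.2 + δ) = ((proj m n L p).1, (proj m n L p).2 + δ) := by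
    intro δ; simp [proj]; ring
  have e1 : IsNonLink m n K (proj m n L p) v ↔
      v = proj m n L (p.1, p.2 + hstep K p.1) ∨ v = proj m n L (p.1, p.2 + -hstep K p.1) := by
    rw [e, e]; unfold IsNonLink; rw [hs, Prod.ext_iff, Prod.ext_iff]
    simp only [Int.cast_neg, ← sub_eq_add_neg]
    tauto
  have e2 : (∃ c : Fin 3, c ≠ 2 ∧ v = proj m n L (act K c p)) ↔
      v = proj m n L (act K 0 p) ∨ v = proj m n L (act K 1 p) := by
    constructor
    · rintro ⟨c, hc, h⟩
      fin_cases c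
      · exact .inl h
      · exact .inr h
      · exact absurd rfl hc
    · rintro (h | h)
      · exact ⟨0, by decide, h⟩
      · exact ⟨1, by decide, h⟩
  rw [e1, e2]
  rcases sgn_eq p with ⟨_, h⟩ | ⟨_, h⟩ <;> simp [act, h, or_comm]

theorem isLink_symm {ℓ : ZMod n} {v w : Vert m n} (h : IsLink m n ℓ v w) : IsLink m n ℓ w v :=
  Or.symm h

theorem isNonLink_symm {k : ZMod n} {v w : Vert m n} (h : IsNonLink m n k v w) :
    IsNonLink m n k w v := by
  obtain ⟨h1, h2⟩ := h
  refine ⟨h1.symm, ?_⟩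
  rw [h1]
  rcases h2 with h2 | h2
  · right; rw [h2]; ring
  · left; rw [h2]; ring

theorem adj_proj_iff (hd : LatticeData m n K L) (p : ℤ × ℤ) (v : Vert m n) :
    (Xa m n K L).Adj (proj m n L p) v ↔
      proj m n L p ≠ v ∧ ∃ c : Fin 3, v = proj m n L (act K c p) := by
  unfold Xa
  rw [SimpleGraph.fromRel_adj]
  refine and_congr_right fun _ => ?_
  have : ((IsLink m n L (proj m n L p) v ∨ IsNonLink m n K (proj m n L p) v) ∨
      (IsLink m n L v (proj m n L p) ∨ IsNonLink m n K v (proj m n L p))) ↔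
      (IsLink m n L (proj m n L p) v ∨ IsNonLink m n K (proj m n L p) v) := by
    constructor
    · rintro (h | h | h)
      · exact h
      · exact .inl (isLink_symm h)
      · exact .inr (isNonLink_symm h)
    · exact .inl
  rw [this, isLink_proj hd, isNonLink_proj hd]
  constructor
  · rintro (h | ⟨c, _, h⟩)
    · exact ⟨2, h⟩
    · exact ⟨c, h⟩
  · rintro ⟨c, h⟩
    by_cases hc : c = 2
    · exact .inl (hc ▸ h)
    · exact .inr ⟨c, hc, h⟩

/-! ### Symbolic displacements and short closed walks. -/

/-- Arithmetic conditions on `n` and `K` that follow from `4K = 4`, `2K ≠ 2` and `n ≠ 16`. -/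
structure StepData (n : ℕ) (K : ℤ) (N e : ℤ) : Prop where
  n_eq : (n : ℤ) = 4 * N
  even_N : N % 2 = 0
  six_le : 6 ≤ N
  odd_e : e % 2 = 1
  K_eq : K = 1 + N * e

/-- The symbolic version of `act`: the point `(x, a + b * K)` is represented by `(x, a, b)`. -/
def mact (c : Fin 3) (s : ℤ × ℤ × ℤ) : ℤ × ℤ × ℤ :=
  let ε : ℤ := if (s.1 + s.2.1 + s.2.2) % 2 = 0 then 1 else -1
  if c = 2 then (s.1 + ε, s.2)
  else
    let δ := if c = 0 then ε else -ε
    if s.1 % 2 = 0 then (s.1, s.2.1 + δ, s.2.2) else (s.1, s.2.1, s.2.2 + δ)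

/-- The lattice point represented by a symbolic one. -/
def evalPt (K : ℤ) (s : ℤ × ℤ × ℤ) : ℤ × ℤ := (s.1, s.2.1 + s.2.2 * K)

/-- The end of the walk with the given colours in the lattice. -/
def run (K : ℤ) (w : List (Fin 3)) (p : ℤ × ℤ) : ℤ × ℤ := w.foldl (fun p c => act K c p) p

/-- The end of the walk with the given colours, symbolically. -/
def mrun (w : List (Fin 3)) (s : ℤ × ℤ × ℤ) : ℤ × ℤ × ℤ := w.foldl (fun s c => mact c s) s

/-- The end of the walk with the given colours in the graph. -/
def walk (m n : ℕ) (K L : ℤ) (w : List (Fin 3)) (v : Vert m n) : Vert m n :=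
  w.foldl (fun v c => nb m n K L c v) v

/-- The displacement `(X, A + B * K)` does not lead back to the starting vertex. -/
def ReturnFree (d : ℤ × ℤ × ℤ) : Prop :=
  (d.1 = 0 ∧ (d.2.1 + d.2.2) % 2 = 1) ∨
  (d.1 = 0 ∧ d.2.2 % 2 = 0 ∧ d.2.1 + d.2.2 ≤ 10 ∧ -10 ≤ d.2.1 + d.2.2 ∧
    ¬ (d.2.1 + d.2.2 = 0 ∧ d.2.2 % 4 = 0)) ∨
  d.1 = 1 ∨ d.1 = -1 ∨ d.1 = 2 ∨ d.1 = -2 ∨ d.1 = 3 ∨ d.1 = -3 ∨ d.1 = 5 ∨ d.1 = -5 ∨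
  ((d.1 = 4 ∨ d.1 = -4) ∧
    (((d.2.1 = 2 ∨ d.2.1 = 4 ∨ d.2.1 = -2 ∨ d.2.1 = -4) ∧
        (d.2.2 = 0 ∨ d.2.2 = 2 ∨ d.2.2 = -2)) ∨
      ((d.2.2 = 2 ∨ d.2.2 = 4 ∨ d.2.2 = -2 ∨ d.2.2 = -4) ∧
        (d.2.1 = 0 ∨ d.2.1 = 2 ∨ d.2.1 = -2))))

instance (d : ℤ × ℤ × ℤ) : Decidable (ReturnFree d) := by
  unfold ReturnFree; infer_instance

/-- The displacement of a walk that starts at a point with the parities `e`, `f`. -/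
def disp (e f : Fin 2) (w : List (Fin 3)) : ℤ × ℤ × ℤ :=
  mrun w ((e.val : ℤ), (f.val : ℤ), 0) - ((e.val : ℤ), (f.val : ℤ), 0)

/-- A finite check, since only the parities of the starting point matter. The conditions on `g`
express that the closed walk would not backtrack at its base point. -/
theorem returnFree_trans : ∀ e f : Fin 2, ∀ x y : Fin 3, x ≠ y → ∀ z : Fin 3, z ≠ x →
    ∀ a : Fin 3, a ≠ x → ∀ b : Fin 3, b ≠ a → ∀ c : Fin 3, c ≠ b → ∀ d : Fin 3, d ≠ c →
    ∀ g : Fin 3, g ≠ d → g ≠ x → ReturnFree (disp e f [x, y, x, z, x, a, b, c, d, g]) := by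
  decide +kernel

theorem returnFree_two : ∀ e f : Fin 2, ∀ x y : Fin 3, x ≠ y → ReturnFree (disp e f [x, y]) := by
  decide +kernel

theorem returnFree_one : ∀ e f : Fin 2, ∀ x : Fin 3, ReturnFree (disp e f [x]) := by
  decide +kernel

/-- A displacement `-B + B * K` vanishes modulo `n` when `4 ∣ B`, because `4K = 4`. -/
theorem disp_cis : ∀ e f : Fin 2, ∀ x y z : Fin 3, x ≠ y → y ≠ z → x ≠ z →
    ∀ t : Fin 3, t ≠ x → (disp e f [x, y, z, x, t, x, y, z, x, t]).1 = 0 ∧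
      (disp e f [x, y, z, x, t, x, y, z, x, t]).2.1 +
        (disp e f [x, y, z, x, t, x, y, z, x, t]).2.2 = 0 ∧
      (disp e f [x, y, z, x, t, x, y, z, x, t]).2.2 % 4 = 0 := by
  decide +kernel

theorem act_evalPt (hK : K % 2 = 1) (c : Fin 3) (s : ℤ × ℤ × ℤ) :
    act K c (evalPt K s) = evalPt K (mact c s) := by
  obtain ⟨x, a, b⟩ := s
  have hp : (x + (a + b * K)) % 2 = (x + a + b) % 2 := by
    rw [Int.add_emod x, Int.add_emod a, Int.mul_emod, hK]; simp; omega
  have hs : sgn (evalPt K (x, a, b)) = if (x + a + b) % 2 = 0 then 1 else -1 := by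
    simp only [sgn, evalPt, hp]
  unfold act
  rw [hs]
  simp only [mact, evalPt, hstep]
  split_ifs <;> ext <;> simp only [*, ↓reduceIte] <;> ring

theorem run_evalPt (hK : K % 2 = 1) (w : List (Fin 3)) (s : ℤ × ℤ × ℤ) :
    run K w (evalPt K s) = evalPt K (mrun w s) := by
  induction w generalizing s with
  | nil => rfl
  | cons c w ih =>
    change run K w (act K c (evalPt K s)) = _
    rw [act_evalPt hK, ih]; rfl

theorem run_add (w : List (Fin 3)) (p d : ℤ × ℤ) (h1 : d.1 % 2 = 0) (h2 : d.2 % 2 = 0) :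
    run K w (p + d) = run K w p + d := by
  induction w generalizing p with
  | nil => rfl
  | cons c w ih =>
    change run K w (act K c (p + d)) = run K w (act K c p) + d
    rw [act_add c p d h1 h2, ih]

theorem walk_proj (hd : LatticeData m n K L) (w : List (Fin 3)) (p : ℤ × ℤ) :
    walk m n K L w (proj m n L p) = proj m n L (run K w p) := by
  induction w generalizing p with
  | nil => rfl
  | cons c w ih =>
    change walk m n K L w (nb m n K L c (proj m n L p)) = proj m n L (run K w (act K c p))
    rw [nb_proj hd, ih]

/-- Translations with even coordinates commute with `act`, so the displacement depends only on the
parities of a lift of `v`. -/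
theorem exists_disp (hd : LatticeData m n K L) (v : Vert m n) : ∃ e f : Fin 2,
    ∀ w : List (Fin 3), walk m n K L w v = v ↔
      ∃ t : ℤ, (disp e f w).1 = t * m ∧
        (n : ℤ) ∣ (disp e f w).2.1 + (disp e f w).2.2 * K + t * L := by
  obtain ⟨p, rfl⟩ := proj_surjective hd v
  have hf : ∀ a : ℤ, ∃ e : Fin 2, (a - e.val) % 2 = 0 := fun a =>
    ⟨⟨(a % 2).toNat, by omega⟩, by simp only; omega⟩
  obtain ⟨e, he⟩ := hf p.1
  obtain ⟨f, hf⟩ := hf p.2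
  refine ⟨e, f, fun w => ?_⟩
  have e1 : p = evalPt K ((e.val : ℤ), (f.val : ℤ), 0) + (p.1 - e.val, p.2 - f.val) := by
    ext <;> simp [evalPt]
  have e2 : run K w p = evalPt K (mrun w ((e.val : ℤ), (f.val : ℤ), 0)) +
      (p.1 - e.val, p.2 - f.val) := by
    conv_lhs => rw [e1]
    rw [run_add w _ _ he hf, run_evalPt hd.odd_K]
  rw [walk_proj hd, eq_comm, proj_eq_iff hd, e2]
  refine exists_congr fun t => ?_
  simp only [disp, evalPt, Prod.fst_add, Prod.snd_add, Prod.fst_sub, Prod.snd_sub]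
  refine and_congr ⟨fun h => by linarith, fun h => by linarith⟩ ?_
  refine iff_of_eq (congrArg (fun a : ℤ => (n : ℤ) ∣ a) ?_)
  ring

/-- For `m = 4` the graph has no closed walk of the type-`3` shape. -/
def NoWrap (m n : ℕ) (K L : ℤ) : Prop :=
  m = 4 → ∀ A B : ℤ, (A = 2 ∨ A = 4 ∨ A = -2 ∨ A = -4) → (B = 0 ∨ B = 2 ∨ B = -2) →
    ¬ (n : ℤ) ∣ A + B * K + L ∧ ¬ (n : ℤ) ∣ B + A * K + L

/-- Write `B = 2b`. Modulo `2N` only `A + B` remains, and `|A + B| ≤ 10 < 12 ≤ 2N` forces it to be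
zero. What is left is `2N * b * e` modulo `4N`, with `e` odd. -/
theorem StepData.dvd_iff {N e : ℤ} (hs : StepData n K N e) {A B : ℤ} (hB : B % 2 = 0)
    (h1 : A + B ≤ 10) (h2 : -10 ≤ A + B) :
    (n : ℤ) ∣ A + B * K ↔ A + B = 0 ∧ B % 4 = 0 := by
  obtain ⟨hn, hN, h6, he, rfl⟩ := hs
  obtain ⟨b, rfl⟩ : ∃ b, B = 2 * b := ⟨B / 2, by omega⟩
  have hr : A + 2 * b * (1 + N * e) = (A + 2 * b) + 2 * N * (b * e) := by ring
  rw [hn, hr]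
  constructor
  · intro h
    have h0 : A + 2 * b = 0 := by
      have h3 : 2 * N ∣ A + 2 * b :=
        (Int.dvd_add_left ⟨b * e, rfl⟩).1 (Dvd.dvd.trans ⟨2, by ring⟩ h)
      exact Int.eq_zero_of_abs_lt_dvd h3 (by rw [abs_lt]; constructor <;> omega)
    rw [h0, zero_add, show 4 * N = 2 * N * 2 by ring] at h
    have h4 := Int.dvd_of_mul_dvd_mul_left (by omega) h
    refine ⟨h0, ?_⟩
    rcases Int.even_or_odd b with hb | hb
    · obtain ⟨c, rfl⟩ := hb; omega
    · exact absurd h4 (by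
        rw [← even_iff_two_dvd, Int.not_even_iff_odd]
        exact hb.mul (Int.odd_iff.2 he))
  · rintro ⟨h, h'⟩
    obtain ⟨c, rfl⟩ : ∃ c, b = 2 * c := ⟨b / 2, by omega⟩
    exact ⟨c * e, by rw [h]; ring⟩

theorem walk_ne (hd : LatticeData m n K L) {N E : ℤ} (hs : StepData n K N E)
    (hw : NoWrap m n K L) (w : List (Fin 3)) (h : ∀ e f, ReturnFree (disp e f w))
    (v : Vert m n) : walk m n K L w v ≠ v := by
  obtain ⟨e, f, hv⟩ := exists_disp hd v
  rw [ne_eq, hv w]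
  have h4 := hd.four_le
  have hm := hd.even_m
  rintro ⟨t, h1, h2⟩
  have hr := h e f
  generalize disp e f w = d at hr h1 h2
  obtain ⟨X, A, B⟩ := d
  simp only [ReturnFree] at hr h1 h2
  have ht : ∀ a b : ℤ, X = a → t * m = b → b = a := by
    intro a b ha hb; rw [← ha, ← hb, h1]
  -- `ReturnFree` allows a nonzero first coordinate of size at most 5, so only `t = ±1` with `m = 4`
  -- can survive.
  have small : t = 0 ∨ t = 1 ∨ t = -1 ∨ 8 ≤ t * m ∨ t * m ≤ -8 := by
    rcases le_or_gt 2 t with h | h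
    · right; right; right; left; nlinarith
    · rcases le_or_gt t (-2) with h' | h'
      · right; right; right; right; nlinarith
      · omega
  have hz : X = 0 → t = 0 := by
    intro hX
    rw [hX] at h1
    rcases mul_eq_zero.1 h1.symm with h | h <;> omega
  rcases hr with ⟨hX, hp⟩ | ⟨hX, hB, hA1, hA2, hc⟩ | hr
  · rw [hz hX, zero_mul, add_zero] at h2
    have h3 : (2 : ℤ) ∣ A + B * K :=
      Dvd.dvd.trans ⟨2 * N, by rw [hs.n_eq]; ring⟩ h2
    have : (A + B * K) % 2 = (A + B) % 2 := by
      rw [Int.add_emod, Int.mul_emod, hd.odd_K]; simp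
    omega
  · rw [hz hX, zero_mul, add_zero] at h2
    exact hc ((hs.dvd_iff hB hA1 hA2).1 h2)
  · rcases small with rfl | rfl | rfl | h | h
    · omega
    · have hX : X = 4 := by omega
      have hm4 : m = 4 := by omega
      rcases hr with hr | hr | hr | hr | hr | hr | hr | hr | ⟨_, ⟨ha, hb⟩ | ⟨hb, ha⟩⟩ <;>
        first
        | omega
        | (rw [one_mul] at h2
           first
           | exact (hw hm4 A B ha hb).1 h2
           | exact (hw hm4 B A hb ha).2 h2)
    · have hX : X = -4 := by omega
      have hm4 : m = 4 := by omega
      -- Negating the displacement reduces a turn in the opposite direction to the form used in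
      -- `NoWrap`.
      have h2' : (n : ℤ) ∣ -A + -B * K + L := by
        rw [show -A + -B * K + L = -(A + B * K + -1 * L) by ring]
        exact (dvd_neg (b := A + B * K + -1 * L)).2 h2
      rcases hr with hr | hr | hr | hr | hr | hr | hr | hr | ⟨_, ⟨ha, hb⟩ | ⟨hb, ha⟩⟩ <;>
        first
        | omega
        | exact (hw hm4 (-A) (-B) (by omega) (by omega)).1 h2'
        | exact (hw hm4 (-B) (-A) (by omega) (by omega)).2 h2'
    · omega
    · omega

theorem walk_cis (hd : LatticeData m n K L) {N E : ℤ} (hs : StepData n K N E)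
    {x y z t : Fin 3} (hxy : x ≠ y) (hyz : y ≠ z) (hxz : x ≠ z) (ht : t ≠ x) (v : Vert m n) :
    walk m n K L [x, y, z, x, t, x, y, z, x, t] v = v := by
  obtain ⟨e, f, hv⟩ := exists_disp hd v
  obtain ⟨h1, h2, h3⟩ := disp_cis e f x y z hxy hyz hxz t ht
  rw [hv]
  refine ⟨0, by rw [h1, zero_mul], ?_⟩
  rw [zero_mul, add_zero]
  exact (hs.dvd_iff (by omega) (by omega) (by omega)).2 ⟨h2, h3⟩

/-! ### Reading the colouring off the 10-cycles. -/

/-- A path of length `5` with first vertices `v₀, v₁` and last vertices `v₄, v₅` extends to a closed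
non-backtracking walk of length `10`. -/
def Closes {V : Type*} (G : SimpleGraph V) (v₀ v₁ v₄ v₅ : V) : Prop :=
  ∃ v₆ v₇ v₈ v₉ : V, G.Adj v₅ v₆ ∧ G.Adj v₆ v₇ ∧ G.Adj v₇ v₈ ∧ G.Adj v₈ v₉ ∧ G.Adj v₉ v₀ ∧
    v₆ ≠ v₄ ∧ v₇ ≠ v₅ ∧ v₈ ≠ v₆ ∧ v₉ ≠ v₇ ∧ v₀ ≠ v₈ ∧ v₁ ≠ v₉

/-- The path `v₀, v₁, v₂, v₃` has an extension by one edge, all of whose extensions by one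
more edge extend to closed non-backtracking walks of length `10`. -/
def Cis {V : Type*} (G : SimpleGraph V) (v₀ v₁ v₂ v₃ : V) : Prop :=
  ∃ v₄ : V, G.Adj v₃ v₄ ∧ v₄ ≠ v₂ ∧ ∀ v₅ : V, G.Adj v₄ v₅ → v₅ ≠ v₃ → Closes G v₀ v₁ v₄ v₅

theorem Closes.map {V W : Type*} {G : SimpleGraph V} {H : SimpleGraph W} (η : G ≃g H)
    {v₀ v₁ v₄ v₅ : V} (h : Closes G v₀ v₁ v₄ v₅) : Closes H (η v₀) (η v₁) (η v₄) (η v₅) := by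
  obtain ⟨v₆, v₇, v₈, v₉, h⟩ := h
  exact ⟨η v₆, η v₇, η v₈, η v₉, by simpa only [SimpleGraph.Iso.map_adj_iff, ne_eq,
    EmbeddingLike.apply_eq_iff_eq] using h⟩

theorem Cis.map {V W : Type*} {G : SimpleGraph V} {H : SimpleGraph W} (η : G ≃g H)
    {v₀ v₁ v₂ v₃ : V} (h : Cis G v₀ v₁ v₂ v₃) : Cis H (η v₀) (η v₁) (η v₂) (η v₃) := by
  obtain ⟨v₄, h1, h2, h3⟩ := h
  refine ⟨η v₄, η.map_adj_iff.2 h1, fun h => h2 (η.injective h), fun w hw hne => ?_⟩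
  obtain ⟨v₅, rfl⟩ := η.surjective w
  exact (h3 v₅ (η.map_adj_iff.1 hw) (fun h => hne (congrArg η h))).map η

theorem cis_map_iff {V : Type*} {G : SimpleGraph V} (η : G ≃g G) {v₀ v₁ v₂ v₃ : V} :
    Cis G (η v₀) (η v₁) (η v₂) (η v₃) ↔ Cis G v₀ v₁ v₂ v₃ :=
  ⟨fun h => by simpa using h.map η.symm, fun h => h.map η⟩

/-- The hypotheses under which the `10`-cycles of `X_a(m,n,K,L)` determine its local structure. -/
structure TenCycleData (m n : ℕ) (K L N E : ℤ) : Prop where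
  lat : LatticeData m n K L
  stepData : StepData n K N E
  noWrap : NoWrap m n K L

variable {N E : ℤ}

theorem nb_ne (hd : TenCycleData m n K L N E) (c : Fin 3) (v : Vert m n) :
    nb m n K L c v ≠ v :=
  walk_ne hd.lat hd.stepData hd.noWrap [c] (fun e f => returnFree_one e f c) v

theorem nb_injective (hd : TenCycleData m n K L N E) (v : Vert m n) :
    Function.Injective (fun c => nb m n K L c v) := by
  intro c c' h
  by_contra hc
  refine walk_ne hd.lat hd.stepData hd.noWrap [c, c'] (fun e f => returnFree_two e f c c' hc) v ?_
  change nb m n K L c' (nb m n K L c v) = v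
  rw [show nb m n K L c v = nb m n K L c' v from h, nb_nb hd.lat]

theorem adj_iff (hd : TenCycleData m n K L N E) (v w : Vert m n) :
    (Xa m n K L).Adj v w ↔ ∃ c, w = nb m n K L c v := by
  obtain ⟨p, rfl⟩ := proj_surjective hd.lat v
  rw [adj_proj_iff hd.lat]
  simp only [nb_proj hd.lat]
  refine ⟨fun h => h.2, fun ⟨c, h⟩ => ⟨?_, c, h⟩⟩
  rw [h, ← nb_proj hd.lat]
  exact (nb_ne hd c _).symm

theorem nb_nb_ne_iff (hd : TenCycleData m n K L N E) (v : Vert m n) (a b : Fin 3) :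
    nb m n K L b (nb m n K L a v) ≠ v ↔ b ≠ a := by
  refine not_congr ⟨fun h => ?_, fun h => by rw [h, nb_nb hd.lat]⟩
  refine nb_injective hd (nb m n K L a v) ?_
  simp only [nb_nb hd.lat]
  exact h

/-- If `x, y, z` are distinct, take `x` as fourth colour: for either fifth colour `t` the word
`xyzxt` repeated twice closes. If `z = x`, then after any fourth colour the fifth colour `x` cannot
be completed, by `returnFree_trans`. -/
theorem cis_iff (hd : TenCycleData m n K L N E) (v : Vert m n) {x y z : Fin 3}
    (hxy : x ≠ y) (hyz : y ≠ z) :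
    Cis (Xa m n K L) v (nb m n K L x v) (nb m n K L y (nb m n K L x v))
      (nb m n K L z (nb m n K L y (nb m n K L x v))) ↔ x ≠ z := by
  have adj : ∀ u a, (Xa m n K L).Adj u (nb m n K L a u) := fun u a => (adj_iff hd _ _).2 ⟨a, rfl⟩
  constructor
  · rintro ⟨v₄, h34, hne, H⟩ rfl
    obtain ⟨t, rfl⟩ := (adj_iff hd _ _).1 h34
    have htx : t ≠ x := (nb_nb_ne_iff hd _ _ _).1 hne
    obtain ⟨v₆, v₇, v₈, v₉, h56, h67, h78, h89, h90, n6, n7, n8, n9, n0, n1⟩ :=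
      H _ (adj _ x) ((nb_nb_ne_iff hd _ _ _).2 htx.symm)
    obtain ⟨a, rfl⟩ := (adj_iff hd _ _).1 h56
    have ha := (nb_nb_ne_iff hd _ _ _).1 n6
    obtain ⟨b, rfl⟩ := (adj_iff hd _ _).1 h67
    have hb := (nb_nb_ne_iff hd _ _ _).1 n7
    obtain ⟨c, rfl⟩ := (adj_iff hd _ _).1 h78
    have hc := (nb_nb_ne_iff hd _ _ _).1 n8
    obtain ⟨d, rfl⟩ := (adj_iff hd _ _).1 h89
    have hd' := (nb_nb_ne_iff hd _ _ _).1 n9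
    obtain ⟨g, hg⟩ := (adj_iff hd _ _).1 h90
    have hgd : g ≠ d := (nb_nb_ne_iff hd _ _ _).1 (fun h => n0 (hg.trans h))
    have hgx : g ≠ x := by
      intro h
      apply n1
      have h9 := congrArg (nb m n K L g) hg
      rw [nb_nb hd.lat, h] at h9
      exact h9
    exact walk_ne hd.lat hd.stepData hd.noWrap [x, y, x, t, x, a, b, c, d, g]
      (fun e f => returnFree_trans e f x y hxy t htx a ha b hb c hc d hd' g hgd hgx) v hg.symm
  · intro hxz
    refine ⟨_, adj _ x, (nb_nb_ne_iff hd _ _ _).2 hxz, ?_⟩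
    intro v₅ h45 hne
    obtain ⟨t, rfl⟩ := (adj_iff hd _ _).1 h45
    have ht : t ≠ x := (nb_nb_ne_iff hd _ _ _).1 hne
    have hcl := walk_cis hd.lat hd.stepData hxy hyz hxz ht v
    simp only [walk, List.foldl_cons, List.foldl_nil] at hcl
    have h9 := congrArg (nb m n K L t) hcl
    rw [nb_nb hd.lat] at h9
    refine ⟨_, _, _, nb m n K L t v, adj _ x, adj _ y, adj _ z, ?_, (adj v t).symm,
      (nb_nb_ne_iff hd _ _ _).2 ht.symm, (nb_nb_ne_iff hd _ _ _).2 hxy.symm,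
      (nb_nb_ne_iff hd _ _ _).2 hyz.symm, ?_, ?_, ?_⟩
    · rw [← h9]; exact adj _ x
    · rw [← h9]; exact (nb_nb_ne_iff hd _ _ _).2 hxz
    · intro h
      have h8 := congrArg (nb m n K L x) h
      rw [h9] at h8
      exact ht.symm (nb_injective hd v h8)
    · exact fun h => ht.symm (nb_injective hd v h)

/-! ### Automorphisms act by a constant permutation of colours. -/

/-- An automorphism permutes the colours at each vertex. -/
theorem exists_colour (hd : TenCycleData m n K L N E) (η : Xa m n K L ≃g Xa m n K L)
    (v : Vert m n) : ∃ σ : Fin 3 → Fin 3, Function.Injective σ ∧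
      ∀ c, η (nb m n K L c v) = nb m n K L (σ c) (η v) := by
  have h : ∀ c, ∃ c', η (nb m n K L c v) = nb m n K L c' (η v) := fun c =>
    (adj_iff hd _ _).1 (η.map_adj_iff.2 ((adj_iff hd _ _).2 ⟨c, rfl⟩))
  choose σ hσ using h
  refine ⟨σ, fun a b hab => ?_, hσ⟩
  have := hσ a
  rw [hab, ← hσ b] at this
  exact nb_injective hd v (η.injective this)

/-- The edge of colour `y` is shared, so both ends agree on `y`. For `c ≠ y` the path with colours
`c, y, c` centred on that edge is not `Cis`; neither is its image with colours `σ c, σ y, τ c`,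
whence `τ c = σ c`. -/
theorem colour_nb (hd : TenCycleData m n K L N E) (η : Xa m n K L ≃g Xa m n K L)
    {v : Vert m n} {σ : Fin 3 → Fin 3} (hinj : Function.Injective σ)
    (hσ : ∀ c, η (nb m n K L c v) = nb m n K L (σ c) (η v)) (y c : Fin 3) :
    η (nb m n K L c (nb m n K L y v)) = nb m n K L (σ c) (η (nb m n K L y v)) := by
  obtain ⟨τ, hτ, hτ'⟩ := exists_colour hd η (nb m n K L y v)
  have hy : τ y = σ y := by
    have h1 := hτ' y
    rw [nb_nb hd.lat, hσ y] at h1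
    refine nb_injective hd (nb m n K L (σ y) (η v)) ?_
    simp only [nb_nb hd.lat]
    exact h1.symm
  rw [hτ']
  congr 1
  by_cases hc : c = y
  · rw [hc, hy]
  · have h1 := cis_iff hd (nb m n K L c v) hc (Ne.symm hc)
    simp only [nb_nb hd.lat, ne_eq, not_true,
      iff_false] at h1
    rw [← cis_map_iff η, hτ', hσ, hσ] at h1
    have h2 := cis_iff hd (nb m n K L (σ c) (η v)) (x := σ c) (y := σ y) (z := τ c)
      (fun h => hc (hinj h)) (fun h => hc (hτ (hy.trans h)).symm)
    simp only [nb_nb hd.lat] at h2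
    by_contra h
    exact h1 (h2.2 (Ne.symm h))

theorem map_walk (hd : TenCycleData m n K L N E) (η : Xa m n K L ≃g Xa m n K L)
    {σ : Fin 3 → Fin 3} (hinj : Function.Injective σ) (w : List (Fin 3)) {v : Vert m n}
    (hσ : ∀ c, η (nb m n K L c v) = nb m n K L (σ c) (η v)) :
    η (walk m n K L w v) = walk m n K L (w.map σ) (η v) := by
  induction w generalizing v with
  | nil => rfl
  | cons y w ih =>
    change η (walk m n K L w (nb m n K L y v)) =
      walk m n K L (w.map σ) (nb m n K L (σ y) (η v))
    rw [ih (colour_nb hd η hinj hσ y), hσ]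

theorem injective_fin_three : ∀ σ : Fin 3 → Fin 3, Function.Injective σ → (∀ c, σ c ≠ c) →
    (∀ c, σ c = c + 1) ∨ (∀ c, σ (σ c) = c + 1) := by
  decide

/-- The closed walks at a vertex at which an automorphism rotates are closed under the cyclic
change of colours. -/
theorem walk_rotate (hd : TenCycleData m n K L N E) {η : Xa m n K L ≃g Xa m n K L}
    {v : Vert m n} (hη : RotatesAt (Xa m n K L) η v) (w : List (Fin 3))
    (hw : walk m n K L w v = v) : walk m n K L (w.map (· + 1)) v = v := by
  obtain ⟨hv, a, b, c, hab, hbc, hac, hN, ha, hb, hc⟩ := hη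
  obtain ⟨σ, hinj, hσ⟩ := exists_colour hd η v
  have hfix : ∀ x, σ x ≠ x := by
    intro x hx
    have h1 := hσ x
    rw [hx, hv] at h1
    have h2 : nb m n K L x v ∈ (Xa m n K L).neighborSet v := (adj_iff hd _ _).2 ⟨x, rfl⟩
    rw [hN] at h2
    rcases h2 with h2 | h2 | h2 <;> rw [h2] at h1
    · exact hab (h1.symm.trans ha)
    · exact hbc (h1.symm.trans hb)
    · exact hac (hc.symm.trans h1)
  have step : ∀ w, walk m n K L w v = v → walk m n K L (w.map σ) v = v := by
    intro w hw
    have h := map_walk hd η hinj w hσ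
    rw [hw, hv] at h
    exact h.symm
  -- A 3-cycle on the colours is `c ↦ c + 1` or its inverse; in the second case its square is used.
  rcases injective_fin_three σ hinj hfix with h | h
  · rw [show (fun c : Fin 3 => c + 1) = σ from funext fun c => (h c).symm]
    exact step w hw
  · rw [show (fun c : Fin 3 => c + 1) = σ ∘ σ from funext fun c => (h c).symm, ← List.map_map]
    exact step _ (step w hw)

/-! ### Explicit 10-cycles of types 2 and 3. -/

theorem proj_eq_of_small (hd : LatticeData m n K L) {p q : ℤ × ℤ}
    (h : proj m n L p = proj m n L q) (h1 : q.1 - p.1 < 4) (h2 : -4 < q.1 - p.1) :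
    p.1 = q.1 ∧ (n : ℤ) ∣ q.2 - p.2 := by
  have h4 := hd.four_le
  obtain ⟨t, ht, hn⟩ := (proj_eq_iff hd p q).1 h
  have h0 : t = 0 := by
    have h5 : (m : ℤ) ∣ q.1 - p.1 := ⟨t, by rw [ht]; ring⟩
    have h6 := Int.eq_zero_of_abs_lt_dvd h5 (by rw [abs_lt]; constructor <;> omega)
    rw [ht, add_sub_cancel_left] at h6
    rcases mul_eq_zero.1 h6 with h | h <;> omega
  rw [h0] at ht hn
  exact ⟨by simpa using ht.symm, by simpa using hn⟩

theorem isLink_proj_act_iff (hd : LatticeData m n K L) (c : Fin 3) (p : ℤ × ℤ) :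
    IsLink m n L (proj m n L p) (proj m n L (act K c p)) ↔ c = 2 := by
  rw [isLink_proj hd]
  refine ⟨fun h => ?_, fun h => by rw [h]⟩
  by_contra hc
  have e1 : (act K c p).1 = p.1 := by simp [act, hc]
  have e2 : (act K 2 p).1 = p.1 + sgn p := by simp [act]
  have hs := sgn_eq p
  have := (proj_eq_of_small hd h (by rw [e1, e2]; omega) (by rw [e1, e2]; omega)).1
  rw [e1, e2] at this
  omega

theorem hasTenCycle_of_lattice (hd : LatticeData m n K L) {code : Fin 10 → ℕ}
    (P : Fin 10 → ℤ × ℤ) (hinj : Function.Injective (fun t => proj m n L (P t)))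
    (h : ∀ t, ∃ c, proj m n L (P (t + 1)) = proj m n L (act K c (P t)) ∧
      (c = 2 ↔ code t = 0)) : HasTenCycle m n K L code := by
  refine ⟨fun t => proj m n L (P t), hinj, fun t => ?_⟩
  obtain ⟨c, hc, hcode⟩ := h t
  refine ⟨(adj_proj_iff hd _ _).2 ⟨fun h => ?_, c, hc⟩, ?_⟩
  · exact (by decide : ∀ t : Fin 10, t ≠ t + 1) t (hinj h)
  · simp only [hc]
    rw [isLink_proj_act_iff hd, hcode]

theorem exists_act_nonlink (x y : ℤ) {a : ℤ} (ha : a = hstep K x ∨ a = -hstep K x) :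
    ∃ c : Fin 3, c ≠ 2 ∧ act K c (x, y) = (x, y + a) := by
  rcases sgn_eq (x, y) with ⟨_, hs⟩ | ⟨_, hs⟩ <;> rcases ha with rfl | rfl
  · exact ⟨0, by decide, by simp [act, hs]⟩
  · exact ⟨1, by decide, by simp [act, hs]⟩
  · exact ⟨1, by decide, by simp [act, hs]⟩
  · exact ⟨0, by decide, by simp [act, hs]⟩

theorem act_link_up {x y : ℤ} (h : (x + y) % 2 = 0) : act K 2 (x, y) = (x + 1, y) := by
  simp [act, sgn, h]

theorem act_link_down {x y : ℤ} (h : (x + y) % 2 = 1) : act K 2 (x, y) = (x - 1, y) := by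
  simp [act, sgn, h, sub_eq_add_neg]

/-- Here `6 + 2K ≡ 0` modulo 16, so six steps in layer 0 and two steps in layer 1 cancel. -/
theorem hasTenCycleType2_of_eq_sixteen (hd : LatticeData m 16 K L) (hK : K % 8 = 5) :
    HasTenCycleType2 m 16 K L := by
  have nonlink : ∀ (x y : ℤ) {a z : ℤ}, z = y + a → (a = hstep K x ∨ a = -hstep K x) →
      ∃ c : Fin 3, proj m 16 L (x, z) = proj m 16 L (act K c (x, y)) ∧ (c = 2 ↔ (1 = 0)) := by
    rintro x y a z rfl ha
    obtain ⟨c, h1, h2⟩ := exists_act_nonlink x y ha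
    exact ⟨c, by rw [h2], by simp [h1]⟩
  have h0 : hstep K 0 = 1 := by simp [hstep]
  have h1 : hstep K 1 = K := by simp [hstep]
  refine hasTenCycle_of_lattice hd ![(0, 0), (0, 1), (0, 2), (0, 3), (0, 4), (0, 5), (0, 6),
    (1, 6), (1, 6 + K), (1, 6 + 2 * K)] ?_ ?_
  · intro s t h
    have key := proj_eq_of_small hd h
    clear h
    fin_cases s <;> fin_cases t <;> first | rfl | (exfalso; simp at key; try omega)
  · intro t
    fin_cases t
    · exact nonlink 0 0 (a := 1) (by norm_num) (by simp [h0])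
    · exact nonlink 0 1 (a := 1) (by norm_num) (by simp [h0])
    · exact nonlink 0 2 (a := 1) (by norm_num) (by simp [h0])
    · exact nonlink 0 3 (a := 1) (by norm_num) (by simp [h0])
    · exact nonlink 0 4 (a := 1) (by norm_num) (by simp [h0])
    · exact nonlink 0 5 (a := 1) (by norm_num) (by simp [h0])
    · refine ⟨2, ?_, by simp⟩
      change proj m 16 L (1, 6) = proj m 16 L (act K 2 (0, 6))
      rw [act_link_up (by norm_num)]; rfl
    · exact nonlink 1 6 (a := K) (by ring) (by simp [h1])
    · exact nonlink 1 (6 + K) (a := K) (by ring) (by simp [h1])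
    · refine ⟨2, ?_, by simp⟩
      change proj m 16 L (0, 0) = proj m 16 L (act K 2 (1, 6 + 2 * K))
      rw [act_link_down (by omega), proj_eq_iff hd]
      exact ⟨0, by norm_num, by simp; omega⟩

theorem hasTenCycleType3_of_dvd (hd : LatticeData 4 n K L) (x a b c d : ℤ)
    (ha : a = hstep K x ∨ a = -hstep K x)
    (hb : b = hstep K (x + 1) ∨ b = -hstep K (x + 1))
    (hc : c = hstep K x ∨ c = -hstep K x)
    (hd' : d = hstep K (x + 1) ∨ d = -hstep K (x + 1))
    (hmul : ∀ y i : ℤ, 1 ≤ i → i ≤ 3 → ¬ (n : ℤ) ∣ i * hstep K y)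
    (h : (n : ℤ) ∣ 3 * a + b + c + d + L) : HasTenCycleType3 4 n K L := by
  have nonlink : ∀ (u y : ℤ) {a z : ℤ}, z = y + a → (a = hstep K u ∨ a = -hstep K u) →
      ∃ c : Fin 3, proj 4 n L (u, z) = proj 4 n L (act K c (u, y)) ∧ (c = 2 ↔ (1 = 0)) := by
    rintro x y a z rfl ha
    obtain ⟨c, h1, h2⟩ := exists_act_nonlink x y ha
    exact ⟨c, by rw [h2], by simp [h1]⟩
  have up : ∀ (u y : ℤ) {v : ℤ}, v = u + 1 → (u + y) % 2 = 0 →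
      ∃ c : Fin 3, proj 4 n L (v, y) = proj 4 n L (act K c (u, y)) ∧ (c = 2 ↔ (0 = 0)) := by
    rintro u y v rfl huy
    exact ⟨2, by rw [act_link_up huy], by simp⟩
  have nd : ∀ {a y : ℤ}, (a = hstep K y ∨ a = -hstep K y) →
      ¬ (n : ℤ) ∣ a ∧ ¬ (n : ℤ) ∣ 2 * a ∧ ¬ (n : ℤ) ∣ 3 * a := by
    intro a y ha
    have h1 := hmul y 1 (by norm_num) (by norm_num)
    have h2 := hmul y 2 (by norm_num) (by norm_num)
    have h3 := hmul y 3 (by norm_num) (by norm_num)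
    rw [one_mul] at h1
    rcases ha with rfl | rfl
    · exact ⟨h1, h2, h3⟩
    · simp only [mul_neg, dvd_neg]; exact ⟨h1, h2, h3⟩
  have odd : ∀ {a y : ℤ}, (a = hstep K y ∨ a = -hstep K y) → a % 2 = 1 := by
    intro a y ha
    have := hstep_odd hd.odd_K y
    omega
  have step2 : hstep K (x + 1 + 1) = hstep K x := by
    unfold hstep; congr 1; apply propext; constructor <;> intro <;> omega
  have step3 : hstep K (x + 1 + 1 + 1) = hstep K (x + 1) := by
    unfold hstep; congr 1; apply propext; constructor <;> intro <;> omega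
  have oa := odd ha
  have ob := odd hb
  have oc := odd hc
  have od := odd hd'
  obtain ⟨na1, na2, na3⟩ := nd ha
  have nb1 := (nd hb).1
  have nc1 := (nd hc).1
  have nd1 := (nd hd').1
  -- The number `x + 1` serves both as the next layer and as the second coordinate of the start.
  -- With `x + y` odd, three odd steps make the next link go up; the single non-links then keep all
  -- four links upward, for one full turn.
  set y := x + 1 with hy
  refine hasTenCycle_of_lattice hd ![(x, y), (x, y + a), (x, y + a + a), (x, y + a + a + a),
    (y, y + a + a + a), (y, y + a + a + a + b), (y + 1, y + a + a + a + b),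
    (y + 1, y + a + a + a + b + c), (y + 1 + 1, y + a + a + a + b + c),
    (y + 1 + 1, y + a + a + a + b + c + d)] ?_ ?_
  · refine Function.Injective.of_lt_imp_ne fun s t hst h => ?_
    have hX : ∀ i : Fin 10, (![(x, y), (x, y + a), (x, y + a + a), (x, y + a + a + a),
        (y, y + a + a + a), (y, y + a + a + a + b), (y + 1, y + a + a + a + b),
        (y + 1, y + a + a + a + b + c), (y + 1 + 1, y + a + a + a + b + c),
        (y + 1 + 1, y + a + a + a + b + c + d)] i).1 =
        x + (![0, 0, 0, 0, 1, 1, 2, 2, 3, 3] : Fin 10 → ℤ) i := by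
      intro i
      fin_cases i <;> simp [hy] <;> ring
    have hb := (by decide : ∀ s t : Fin 10,
      (![0, 0, 0, 0, 1, 1, 2, 2, 3, 3] : Fin 10 → ℤ) t -
        (![0, 0, 0, 0, 1, 1, 2, 2, 3, 3] : Fin 10 → ℤ) s < 4 ∧
      -4 < (![0, 0, 0, 0, 1, 1, 2, 2, 3, 3] : Fin 10 → ℤ) t -
        (![0, 0, 0, 0, 1, 1, 2, 2, 3, 3] : Fin 10 → ℤ) s) s t
    obtain ⟨h1, h2⟩ := proj_eq_of_small hd h (by rw [hX, hX]; linarith) (by rw [hX, hX]; linarith)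
    rw [hX, hX] at h1
    have hpair := (by decide : ∀ s t : Fin 10, s < t →
      (![0, 0, 0, 0, 1, 1, 2, 2, 3, 3] : Fin 10 → ℤ) s =
        (![0, 0, 0, 0, 1, 1, 2, 2, 3, 3] : Fin 10 → ℤ) t →
      (s = 0 ∧ t = 1) ∨ (s = 0 ∧ t = 2) ∨ (s = 0 ∧ t = 3) ∨ (s = 1 ∧ t = 2) ∨
      (s = 1 ∧ t = 3) ∨ (s = 2 ∧ t = 3) ∨ (s = 4 ∧ t = 5) ∨ (s = 6 ∧ t = 7) ∨
      (s = 8 ∧ t = 9)) s t hst (by linarith)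
    clear h hX hb h1 hst
    rcases hpair with ⟨rfl, rfl⟩ | ⟨rfl, rfl⟩ | ⟨rfl, rfl⟩ | ⟨rfl, rfl⟩ | ⟨rfl, rfl⟩ |
      ⟨rfl, rfl⟩ | ⟨rfl, rfl⟩ | ⟨rfl, rfl⟩ | ⟨rfl, rfl⟩
    · exact na1 (by convert h2 using 1; simp)
    · exact na2 (by convert h2 using 1; simp; ring)
    · exact na3 (by convert h2 using 1; simp; ring)
    · exact na1 (by convert h2 using 1; simp)
    · exact na2 (by convert h2 using 1; simp; ring)
    · exact na1 (by convert h2 using 1; simp)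
    · exact nb1 (by convert h2 using 1; simp)
    · exact nc1 (by convert h2 using 1; simp)
    · exact nd1 (by convert h2 using 1; simp)
  · intro t
    fin_cases t
    · exact nonlink x _ rfl ha
    · exact nonlink x _ rfl ha
    · exact nonlink x _ rfl ha
    · exact up x _ rfl (by omega)
    · exact nonlink y _ rfl hb
    · exact up y _ rfl (by omega)
    · exact nonlink (y + 1) _ rfl (by rwa [step2])
    · exact up (y + 1) _ rfl (by omega)
    · exact nonlink (y + 1 + 1) _ rfl (by rwa [step3])
    · refine ⟨2, ?_, by simp⟩
      change proj 4 n L (x, y) = proj 4 n L (act K 2 (y + 1 + 1, y + a + a + a + b + c + d))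
      rw [act_link_up (by omega), proj_eq_iff hd]
      refine ⟨1, by simp [hy]; ring, ?_⟩
      convert h using 1
      ring

theorem noWrap_of_not_type3 (hd : LatticeData m n K L) (hs : StepData n K N E)
    (h3 : ¬ HasTenCycleType3 m n K L) : NoWrap m n K L := by
  rintro rfl A B hA hB
  have hmul : ∀ y i : ℤ, 1 ≤ i → i ≤ 3 → ¬ (n : ℤ) ∣ i * hstep K y := by
    obtain ⟨hn, -, h6, -, rfl⟩ := hs
    intro y i h1 h2 h
    have hN : N ∣ i * hstep (1 + N * E) y := Dvd.dvd.trans ⟨4, by rw [hn]; ring⟩ h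
    have hi : N ∣ i := by
      unfold hstep at hN
      split_ifs at hN
      · simpa using hN
      · rw [show i * (1 + N * E) = i + N * (i * E) by ring] at hN
        exact (Int.dvd_add_left ⟨_, rfl⟩).1 hN
    have := Int.le_of_dvd (by omega) hi
    omega
  -- `A` collects the three equal steps and the later single step in layers of one parity; `B`
  -- collects the two single steps in the other layers.
  obtain ⟨e1, e3, h1, h1', hAe⟩ : ∃ e1 e3 : ℤ, (e1 = 1 ∨ e1 = -1) ∧ (e3 = 1 ∨ e3 = -1) ∧
      A = 3 * e1 + e3 := by
    rcases hA with rfl | rfl | rfl | rfl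
    · exact ⟨1, -1, by norm_num⟩
    · exact ⟨1, 1, by norm_num⟩
    · exact ⟨-1, 1, by norm_num⟩
    · exact ⟨-1, -1, by norm_num⟩
  obtain ⟨e2, e4, h2, h2', hBe⟩ : ∃ e2 e4 : ℤ, (e2 = 1 ∨ e2 = -1) ∧ (e4 = 1 ∨ e4 = -1) ∧
      B = e2 + e4 := by
    rcases hB with rfl | rfl | rfl
    · exact ⟨1, -1, by norm_num⟩
    · exact ⟨1, 1, by norm_num⟩
    · exact ⟨-1, -1, by norm_num⟩
  have sgnmul : ∀ {e S : ℤ}, (e = 1 ∨ e = -1) → (e * S = S ∨ e * S = -S) := by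
    rintro e S (rfl | rfl) <;> simp
  subst hAe hBe
  refine ⟨fun h => h3 ?_, fun h => h3 ?_⟩
  · refine hasTenCycleType3_of_dvd hd 0 (e1 * hstep K 0) (e2 * hstep K (0 + 1))
      (e3 * hstep K 0) (e4 * hstep K (0 + 1)) (sgnmul h1) (sgnmul h2) (sgnmul h1') (sgnmul h2')
      hmul ?_
    simp only [hstep]
    norm_num
    convert h using 1; ring
  · refine hasTenCycleType3_of_dvd hd 1 (e1 * hstep K 1) (e2 * hstep K (1 + 1))
      (e3 * hstep K 1) (e4 * hstep K (1 + 1)) (sgnmul h1) (sgnmul h2) (sgnmul h1') (sgnmul h2')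
      hmul ?_
    simp only [hstep]
    norm_num
    convert h using 1; ring

/-! ### The isomorphism that adds `n/2` to both parameters. -/

/-- Half-period shifts of the layers, lifted to the lattice. -/
def shiftIndex (p : ℤ × ℤ) : ℤ := p.1 / 2 + (p.1 % 2) * (p.2 % 2)

/-- The lift to the lattice of the isomorphism from `X_a(m,n,k,ℓ)` to
`X_a(m,n,k+n/2,ℓ+n/2)`. -/
def shiftMap (H : ℤ) (p : ℤ × ℤ) : ℤ × ℤ := (p.1, p.2 + H * shiftIndex p)

theorem LatticeData.shift (hd : LatticeData m n K L) {H : ℤ} (hH : H % 2 = 0) :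
    LatticeData m n (K + H) (L + H) :=
  ⟨hd.four_le, hd.n_pos, hd.even_m, hd.even_n, by have := hd.odd_K; omega,
    by have := hd.even_L; omega⟩

/-- One turn raises `shiftIndex` by `r = m/2`. As `r` is odd, `H * r ≡ H` modulo `n = 2H`, and this
accounts for the change of `L` to `L + H`. -/
theorem proj_shiftMap_eq_iff (hd : LatticeData m n K L) {H r : ℤ} (hn : (n : ℤ) = 2 * H)
    (hH : H % 2 = 0) (hm : (m : ℤ) = 2 * r) (hr : r % 2 = 1) (p q : ℤ × ℤ) :
    proj m n (L + H) (shiftMap H p) = proj m n (L + H) (shiftMap H q) ↔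
      proj m n L p = proj m n L q := by
  rw [proj_eq_iff hd, proj_eq_iff (hd.shift hH)]
  refine exists_congr fun t => and_congr_right fun h1 => ?_
  change q.1 = p.1 + t * m at h1
  have key : q.2 % 2 = p.2 % 2 → shiftIndex q = shiftIndex p + t * r := by
    intro h2
    unfold shiftIndex
    rw [h2, h1, hm, show t * (2 * r) = 2 * (t * r) by ring]
    generalize t * r = z
    rw [show (p.1 + 2 * z) % 2 = p.1 % 2 by omega, show (p.1 + 2 * z) / 2 = p.1 / 2 + z by omega]
    ring
  obtain ⟨u, hu⟩ : ∃ u, r = 2 * u + 1 := ⟨r / 2, by omega⟩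
  have tH : (t * (L + H)) % 2 = 0 := by
    rw [Int.mul_emod, show (L + H) % 2 = 0 by have := hd.even_L; omega]; simp
  have tL : (t * L) % 2 = 0 := by rw [Int.mul_emod, hd.even_L]; simp
  have parH : ∀ a : ℤ, (H * a) % 2 = 0 := fun a => by rw [Int.mul_emod, hH]; simp
  have e : q.2 % 2 = p.2 % 2 →
      q.2 + H * shiftIndex q - (p.2 + H * shiftIndex p) + t * (L + H) =
        (q.2 - p.2 + t * L) + n * (t * (u + 1)) := by
    intro h2
    rw [key h2, hu, hn]; ring
  have hpar : ∀ a : ℤ, (n : ℤ) ∣ a → a % 2 = 0 := fun a ha =>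
    Int.emod_eq_zero_of_dvd (Dvd.dvd.trans ⟨H, hn⟩ ha)
  constructor
  · intro h
    change (n : ℤ) ∣ q.2 + H * shiftIndex q - (p.2 + H * shiftIndex p) + t * (L + H) at h
    have h2 := hpar _ h
    have h3 := parH (shiftIndex q)
    have h4 := parH (shiftIndex p)
    rw [e (by omega)] at h
    exact (Int.dvd_add_left ⟨_, rfl⟩).1 h
  · intro h
    change (n : ℤ) ∣ q.2 + H * shiftIndex q - (p.2 + H * shiftIndex p) + t * (L + H)
    have h2 := hpar _ h
    rw [e (by omega)]
    exact dvd_add h ⟨_, rfl⟩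

/-- Links preserve `shiftIndex`. In odd layers it alternates with the parity of `y`, so a step `K`
gains `0` or `2H` relative to `K + H`, which is invisible modulo `n`. -/
theorem proj_shiftMap_act (hd : LatticeData m n K L) {H : ℤ} (hn : (n : ℤ) = 2 * H)
    (hH : H % 2 = 0) (c : Fin 3) (p : ℤ × ℤ) :
    proj m n (L + H) (shiftMap H (act K c p)) =
      proj m n (L + H) (act (K + H) c (shiftMap H p)) := by
  obtain ⟨x, y⟩ := p
  have hs : sgn (shiftMap H (x, y)) = sgn (x, y) := by
    have : (H * shiftIndex (x, y)) % 2 = 0 := by rw [Int.mul_emod, hH]; simp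
    unfold sgn shiftMap
    congr 1; apply propext
    constructor <;> intro h <;> simp only at h ⊢ <;> omega
  by_cases hc : c = 2
  · rw [act, act, if_pos hc, if_pos hc, hs]
    congr 1
    simp only [shiftMap, shiftIndex, Prod.mk.injEq, true_and, add_right_inj]
    congr 1
    rcases sgn_eq (x, y) with ⟨h, hs⟩ | ⟨h, hs⟩ <;> rw [hs] <;> simp only at h <;>
      rcases Int.emod_two_eq_zero_or_one y with hy | hy <;> rw [hy] <;> omega
  · rw [act, act, if_neg hc, if_neg hc, hs]
    obtain ⟨δ, hδ, hδe⟩ : ∃ δ : ℤ, (δ = 1 ∨ δ = -1) ∧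
        sgn (x, y) * (if c = 0 then 1 else -1) = δ := by
      refine ⟨_, ?_, rfl⟩
      rcases sgn_eq (x, y) with ⟨_, hs⟩ | ⟨_, hs⟩ <;> rw [hs] <;> split_ifs <;> simp
    rw [hδe, proj_eq_iff (hd.shift hH)]
    refine ⟨0, by simp [shiftMap], ?_⟩
    have hK := hd.odd_K
    simp only [shiftMap, shiftIndex, hstep, zero_mul, add_zero]
    by_cases hx : x % 2 = 0
    · simp only [hx, if_true, zero_mul, add_zero, mul_one]
      exact ⟨0, by ring⟩
    · have hx1 : x % 2 = 1 := by omega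
      simp only [hx1, one_mul, one_ne_zero, if_false]
      rcases hδ with rfl | rfl
      · rcases Int.emod_two_eq_zero_or_one y with hy | hy
        · rw [show (y + 1 * K) % 2 = 1 by omega, hy]
          exact ⟨0, by ring⟩
        · rw [show (y + 1 * K) % 2 = 0 by omega, hy]
          exact ⟨1, by rw [hn]; ring⟩
      · rcases Int.emod_two_eq_zero_or_one y with hy | hy
        · rw [show (y + -1 * K) % 2 = 1 by omega, hy]
          exact ⟨-1, by rw [hn]; ring⟩
        · rw [show (y + -1 * K) % 2 = 0 by omega, hy]
          exact ⟨0, by ring⟩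

theorem nonempty_iso_shift (hd : LatticeData m n K L) {H r : ℤ} (hn : (n : ℤ) = 2 * H)
    (hH : H % 2 = 0) (hm : (m : ℤ) = 2 * r) (hr : r % 2 = 1) :
    Nonempty (Xa m n K L ≃g Xa m n ((K + H : ℤ) : ZMod n) ((L + H : ℤ) : ZMod n)) := by
  have : NeZero m := ⟨by have := hd.four_le; omega⟩
  have : NeZero n := ⟨by have := hd.n_pos; omega⟩
  have hd' := hd.shift hH
  choose lift hlift using proj_surjective hd
  have iff := proj_shiftMap_eq_iff hd hn hH hm hr
  let θ : Vert m n → Vert m n := fun v => proj m n (L + H) (shiftMap H (lift v))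
  have hθ : ∀ p, θ (proj m n L p) = proj m n (L + H) (shiftMap H p) := fun p =>
    (iff _ _).2 (hlift _)
  have hinj : Function.Injective θ := fun v w h => by
    rw [← hlift v, ← hlift w]; exact (iff _ _).1 h
  refine ⟨⟨Equiv.ofBijective θ (Finite.injective_iff_bijective.1 hinj), ?_⟩⟩
  intro v w
  obtain ⟨p, rfl⟩ := proj_surjective hd v
  obtain ⟨q, rfl⟩ := proj_surjective hd w
  change (Xa m n ((K + H : ℤ) : ZMod n) ((L + H : ℤ) : ZMod n)).Adj (θ _) (θ _) ↔ _
  rw [hθ, hθ, adj_proj_iff hd', adj_proj_iff hd, ne_eq, ne_eq, iff]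
  refine and_congr_right fun _ => exists_congr fun c => ?_
  rw [← proj_shiftMap_act hd hn hH, iff]

/-! ### Relations obtained by rotating closed words. -/

theorem run_append (w w' : List (Fin 3)) (p : ℤ × ℤ) :
    run K (w ++ w') p = run K w' (run K w p) := by
  simp [run]

theorem run_even (hK : K % 2 = 1) (w : List (Fin 3)) {d : ℤ × ℤ} (h1 : d.1 % 2 = 0)
    (h2 : d.2 % 2 = 0) : run K w d = evalPt K (mrun w (0, 0, 0)) + d := by
  have h := run_evalPt hK w (0, 0, 0)
  have h0 : evalPt K (0, 0, 0) = 0 := by simp [evalPt]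
  rw [h0] at h
  rw [← h, ← run_add w 0 d h1 h2, zero_add]

/-- At points with even coordinates a word has the same displacement as at the origin, so
displacements of words that preserve such points add up. -/
theorem run_pow (hK : K % 2 = 1) (w : List (Fin 3)) {x y : ℤ}
    (hw : evalPt K (mrun w (0, 0, 0)) = (x, y)) (hx : x % 2 = 0) (hy : y % 2 = 0) (r : ℕ)
    {a b : ℤ} (ha : a % 2 = 0) (hb : b % 2 = 0) :
    run K (List.replicate r w).flatten (a, b) = (a + r * x, b + r * y) := by
  induction r generalizing a b with
  | zero => simp [run]
  | succ r ih =>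
    rw [List.replicate_succ, List.flatten_cons, run_append, run_even hK w (d := (a, b)) ha hb, hw]
    change run K _ (x + a, y + b) = _
    rw [ih (by omega) (by omega)]
    push_cast
    ext <;> simp only <;> ring

/-- The relations between the parameters forced by a rotation at `u_{0,0}`. -/
theorem exists_parameters (hd : TenCycleData m n K L N E) {m₀ : ℤ} (hm : (m : ℤ) = 2 * m₀)
    (hK0 : 0 ≤ K) (hL0 : 0 ≤ L) {η : Xa m n K L ≃g Xa m n K L}
    (hη : RotatesAt (Xa m n K L) η (0, 0)) :
    ∃ n₀ p : ℤ, N = n₀ * m ∧ 0 < n₀ ∧ p % 2 = 1 ∧ m₀ * (1 + K) + L = 2 * m * p ∧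
      4 * n₀ ∣ 2 * p * (1 - p) - (1 + K) := by
  have hK := hd.lat.odd_K
  have h4 := hd.lat.four_le
  obtain ⟨hn, hN, h6, hE, hKe⟩ := hd.stepData
  -- Adding 1 to the colours turns the word of `hT` into that of `hU`, the latter into that of `hW`,
  -- and the word of `hZ` into that of `hZ'`.
  have hT : evalPt K (mrun [0, 1, 0, 1] (0, 0, 0)) = (0, 4) := by
    rw [show mrun [0, 1, 0, 1] (0, 0, 0) = (0, 4, 0) by decide]; simp [evalPt]
  have hU : evalPt K (mrun [1, 2, 1, 2] (0, 0, 0)) = (-2, -(1 + K)) := by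
    rw [show mrun [1, 2, 1, 2] (0, 0, 0) = (-2, -1, -1) by decide]; simp [evalPt]; ring
  have hW : evalPt K (mrun [2, 0, 2, 0] (0, 0, 0)) = (2, -(1 + K)) := by
    rw [show mrun [2, 0, 2, 0] (0, 0, 0) = (2, -1, -1) by decide]; simp [evalPt]; ring
  have hZ : evalPt K (mrun [2, 0, 1, 2, 0, 1] (0, 0, 0)) = (0, 2 - 2 * K) := by
    rw [show mrun [2, 0, 1, 2, 0, 1] (0, 0, 0) = (0, 2, -2) by decide]; simp [evalPt]; ring
  have hZ' : evalPt K (mrun [0, 1, 2, 0, 1, 2] (0, 0, 0)) = (0, 2 - 2 * K) := by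
    rw [show mrun [0, 1, 2, 0, 1, 2] (0, 0, 0) = (0, 2, -2) by decide]; simp [evalPt]; ring
  have h00 : ((0, 0) : Vert m n) = proj m n L (0, 0) := by simp [proj]
  have rot : ∀ (w : List (Fin 3)) (a b a' b' : ℤ), run K w (0, 0) = (a, b) →
      run K (w.map (· + 1)) (0, 0) = (a', b') → (∃ t, a = t * m ∧ (n : ℤ) ∣ b + t * L) →
      ∃ t, a' = t * m ∧ (n : ℤ) ∣ b' + t * L := by
    intro w a b a' b' h1 h2 h3
    have h := walk_rotate hd hη w
    rw [h00, walk_proj hd.lat, walk_proj hd.lat, h1, h2, eq_comm, proj_eq_iff hd.lat, eq_comm,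
      proj_eq_iff hd.lat] at h
    simpa using h (by simpa using h3)
  have hm0 : (2 : ℤ) ≤ m₀ := by omega
  obtain ⟨m₁, rfl⟩ : ∃ m₁ : ℕ, m₀ = m₁ := ⟨m₀.toNat, by omega⟩
  obtain ⟨N₁, hN₁⟩ : ∃ N₁ : ℕ, N = 2 * N₁ := ⟨(N / 2).toNat, by omega⟩
  have hmpos : (0 : ℤ) < m := by omega
  -- The first factor moves by `2 - 2K = -2NE ≡ n/2`, and the `N/2` copies of `0101` add another
  -- `n/2`, so the word closes. The rotated word ends in layer `-N`, which forces `m ∣ N`.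
  obtain ⟨t, ht, hdvd⟩ := rot ([2, 0, 1, 2, 0, 1] ++ (List.replicate N₁ [0, 1, 0, 1]).flatten)
    0 (2 - 2 * K + N₁ * 4) (N₁ * -2) (2 - 2 * K + N₁ * -(1 + K))
    (by
      rw [run_append, run_even hK _ (d := (0, 0)) rfl rfl, hZ]
      simp only [Prod.mk_add_mk, add_zero]
      rw [run_pow hK _ hT rfl rfl N₁ rfl (by omega)]
      simp)
    (by
      rw [List.map_append, List.map_flatten, List.map_replicate]
      change run K ([0, 1, 2, 0, 1, 2] ++ (List.replicate N₁ [1, 2, 1, 2]).flatten) (0, 0) = _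
      rw [run_append, run_even hK _ (d := (0, 0)) rfl rfl, hZ']
      simp only [Prod.mk_add_mk, add_zero]
      rw [run_pow hK _ hU rfl (by omega) N₁ rfl (by omega)]
      simp)
    ⟨0, by simp, by
      obtain ⟨j, hj⟩ : ∃ j, E = 2 * j + 1 := ⟨E / 2, by omega⟩
      refine ⟨-j, ?_⟩
      rw [hn, hKe, hj, hN₁]; ring⟩
  obtain ⟨n₀, rfl⟩ : ∃ n₀, t = -n₀ := ⟨-t, by ring⟩
  have hNn : N = n₀ * m := by rw [hN₁]; linarith
  have hn₀ : 0 < n₀ := by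
    have : 0 < n₀ * (m : ℤ) := by omega
    exact pos_of_mul_pos_left this hmpos.le
  have hN1 : (N₁ : ℤ) = n₀ * m₁ := by
    have : 2 * (N₁ : ℤ) = 2 * (n₀ * m₁) := by rw [← hN₁, hNn, hm]; ring
    linarith
  have hA : 4 * (m : ℤ) ∣ 2 * m * E + (m₁ * (1 + K) + L) := by
    have h1 : n₀ * (4 * (m : ℤ)) ∣ n₀ * (2 * m * E + (m₁ * (1 + K) + L)) := by
      rw [show n₀ * (4 * (m : ℤ)) = n by rw [hn, hNn]; ring]
      refine Int.dvd_neg.1 ?_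
      convert hdvd using 1
      rw [hN1]
      have : K = 1 + n₀ * m * E := by rw [hKe, hNn]
      linear_combination (2 : ℤ) * this
    exact Int.dvd_of_mul_dvd_mul_left hn₀.ne' h1
  obtain ⟨s, hs⟩ := hA
  have hA : m₁ * (1 + K) + L = 2 * m * (2 * s - E) := by linarith
  -- `p` is about to be a number of repetitions; nonnegativity of `K` and `L` makes it natural.
  obtain ⟨p, hp⟩ : ∃ p : ℕ, 2 * s - E = p := by
    have h0 : 0 ≤ 2 * (m : ℤ) * (2 * s - E) := by rw [← hA]; positivity
    exact ⟨(2 * s - E).toNat, by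
      have := nonneg_of_mul_nonneg_right h0 (by omega); omega⟩
  rw [hp] at hA
  refine ⟨n₀, p, hNn, hn₀, by omega, hA, ?_⟩
  -- The relation `hA` says exactly that this word closes after one turn, `t = -1`. Its rotation
  -- makes `1 - p` turns.
  obtain ⟨t, ht, hdvd⟩ := rot ((List.replicate m₁ [1, 2, 1, 2]).flatten ++
      (List.replicate (m₁ * p) [0, 1, 0, 1]).flatten)
    (m₁ * -2) (m₁ * -(1 + K) + (m₁ * p : ℕ) * 4) (m₁ * 2 + (m₁ * p : ℕ) * -2)
    (m₁ * -(1 + K) + (m₁ * p : ℕ) * -(1 + K))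
    (by
      rw [run_append, run_pow hK _ hU rfl (by omega) m₁ rfl rfl, run_pow hK _ hT rfl rfl]
      · simp
      · omega
      · rw [zero_add, Int.mul_emod, show -(1 + K) % 2 = 0 by omega]; simp)
    (by
      rw [List.map_append, List.map_flatten, List.map_flatten, List.map_replicate,
        List.map_replicate]
      change run K ((List.replicate m₁ [2, 0, 2, 0]).flatten ++
        (List.replicate (m₁ * p) [1, 2, 1, 2]).flatten) (0, 0) = _
      rw [run_append, run_pow hK _ hW rfl (by omega) m₁ rfl rfl, run_pow hK _ hU rfl (by omega)]
      · simp
      · omega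
      · rw [zero_add, Int.mul_emod, show -(1 + K) % 2 = 0 by omega]; simp)
    ⟨-1, by rw [hm]; ring, 0, by
      push_cast
      rw [hm] at hA
      linear_combination (-1 : ℤ) * hA⟩
  have ht' : t = 1 - p := by
    have : (m : ℤ) * t = m * (1 - p) := by
      rw [mul_comm, ← ht, hm]; push_cast; ring
    exact mul_left_cancel₀ hmpos.ne' this
  rw [ht'] at hdvd
  have h1 : (m : ℤ) * (4 * n₀) ∣ m * (2 * p * (1 - p) - (1 + K)) := by
    rw [show (m : ℤ) * (4 * n₀) = n by rw [hn, hNn]; ring]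
    convert hdvd using 1
    push_cast
    have hA' : L = 2 * m * p - m₁ * (1 + K) := by linarith
    rw [hA', hm]; ring
  exact Int.dvd_of_mul_dvd_mul_left hmpos.ne' h1

/-- Half of `hdvd` reads `p(1 - p) - 1 - m₀n₀E = 2n₀s`; since `p(1 - p)` is even, `m₀n₀E` is odd. -/
theorem final_arithmetic {m₀ n₀ p E K L m : ℤ} (hm : m = 2 * m₀)
    (hp : p % 2 = 1) (hA : m₀ * (1 + K) + L = 2 * m * p)
    (hdvd : 4 * n₀ ∣ 2 * p * (1 - p) - (1 + K)) (hK : K = 1 + n₀ * m * E) :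
    Odd m₀ ∧ Odd n₀ ∧ n₀ ∣ p ^ 2 - p + 1 ∧ L = m * (2 * p - 1 - E * (m₀ * n₀)) := by
  obtain ⟨s, hs⟩ := hdvd
  have h1 : p * (1 - p) - 1 - m₀ * n₀ * E = 2 * n₀ * s := by
    have : 2 * (p * (1 - p) - 1 - m₀ * n₀ * E) = 2 * (2 * n₀ * s) := by
      rw [hK, hm] at hs; linear_combination hs
    linarith
  have hev : (p * (1 - p)) % 2 = 0 := by
    rw [Int.mul_emod, show (1 - p) % 2 = 0 by omega]; simp
  have hodd : Odd (m₀ * n₀ * E) := by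
    rw [Int.odd_iff]
    have : m₀ * n₀ * E = p * (1 - p) - 1 - 2 * (n₀ * s) := by linarith
    omega
  have hodd' := (Int.odd_mul.1 hodd).1
  refine ⟨(Int.odd_mul.1 hodd').1, (Int.odd_mul.1 hodd').2, ⟨-(m₀ * E) - 2 * s, ?_⟩, ?_⟩
  · linear_combination -h1
  · rw [hK] at hA
    rw [hm] at hA ⊢
    linear_combination hA

/-- `E` is the quotient `4(K - 1)/n`, which lies in `[0, 4)`; the values 0 and 2 would give `2K =
2`. Oddness of `K` makes `N` even, and `n ≠ 16` then excludes `N = 4`. -/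
theorem exists_stepData {n : ℕ} {K : ℤ} (hn : 14 ≤ n) (hne : n ≠ 16) (hodd : K % 2 = 1)
    (hn2 : (n : ℤ) % 2 = 0) (hK0 : 0 ≤ K) (hKn : K < n) (h4 : (n : ℤ) ∣ 4 * (K - 1))
    (h2 : ¬ (n : ℤ) ∣ 2 * (K - 1)) :
    ∃ N E : ℤ, StepData n K N E ∧ (E = 1 ∨ E = 3) := by
  obtain ⟨E, hE⟩ := h4
  have hE0 : 0 ≤ E := by
    by_contra h
    have : (n : ℤ) * E ≤ n * (-1) := mul_le_mul_of_nonneg_left (by omega) (by omega)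
    omega
  have hE4 : E < 4 := by
    by_contra h
    have : (n : ℤ) * 4 ≤ n * E := mul_le_mul_of_nonneg_left (by omega) (by omega)
    omega
  have hE' : E = 1 ∨ E = 3 := by
    interval_cases E
    · exact absurd ⟨0, by linarith⟩ h2
    · exact .inl rfl
    · exact absurd ⟨1, by linarith⟩ h2
    · exact .inr rfl
  refine ⟨n / 4, E, ⟨?_, ?_, ?_, ?_, ?_⟩, hE'⟩ <;> rcases hE' with rfl | rfl <;> omega

end AltQuotient

/-! ### Assembly and normalisation of the parameters. -/

theorem mainTheorem6 (m n : ℕ) (k ℓ : ZMod n)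
    (hadm : Admissible m n k ℓ) (hn : 14 ≤ n) (h4k : 4 * k = 4)
    (h2 : ¬ HasTenCycleType2 m n k ℓ) (h3 : ¬ HasTenCycleType3 m n k ℓ)
    (hrot : ∃ η : Xa m n k ℓ ≃g Xa m n k ℓ, RotatesAt (Xa m n k ℓ) η (0, 0)) :
    ∃ k' ℓ' : ZMod n,
      Relation.ReflTransGen (Move m n) (k, ℓ) (k', ℓ') ∧
      Nonempty (Xa m n k ℓ ≃g Xa m n k' ℓ') ∧
      ∃ m₀ n₀ ℓ₀ : ℤ,
        Odd m₀ ∧ Odd n₀ ∧ Even ℓ₀ ∧ 3 ≤ m₀ ∧ 1 ≤ n₀ ∧ 0 ≤ ℓ₀ ∧ ℓ₀ < 4 * n₀ ∧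
        4 ∣ ℓ₀ + m₀ * n₀ - 1 ∧ n₀ ∣ ℓ₀ ^ 2 + 3 ∧
        (m : ℤ) = 2 * m₀ ∧ (n : ℤ) = 4 * n₀ * m ∧
        k' = ((n₀ * m + 1 : ℤ) : ZMod n) ∧ ℓ' = ((ℓ₀ * m : ℤ) : ZMod n) := by
  have : NeZero n := ⟨by omega⟩
  obtain ⟨K, hK0, hKn, rfl⟩ : ∃ K : ℤ, 0 ≤ K ∧ K < n ∧ (K : ZMod n) = k :=
    ⟨k.val, by positivity, by exact_mod_cast ZMod.val_lt k, by simp⟩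
  obtain ⟨L, hL0, rfl⟩ : ∃ L : ℤ, 0 ≤ L ∧ (L : ZMod n) = ℓ :=
    ⟨ℓ.val, by positivity, by simp⟩
  have hn2 : (n : ℤ) % 2 = 0 := by have := Nat.even_iff.1 hadm.even_n; omega
  have hm2 : (m : ℤ) % 2 = 0 := by have := Nat.even_iff.1 hadm.even_m; omega
  have dvd_of_eq : ∀ a b : ℤ, (a : ZMod n) = b → (n : ℤ) ∣ b - a := fun a b =>
    (ZMod.intCast_eq_intCast_iff_dvd_sub a b n).1
  have even_dvd : ∀ a : ℤ, (n : ℤ) ∣ a → a % 2 = 0 := fun a ha =>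
    Int.emod_eq_zero_of_dvd (Dvd.dvd.trans (by omega) ha)
  have hKodd : K % 2 = 1 := by
    obtain ⟨r, hr⟩ := hadm.odd_k
    have := even_dvd _ (dvd_of_eq K (2 * r.val + 1) (by rw [hr]; simp))
    omega
  have hLeven : L % 2 = 0 := by
    obtain ⟨r, hr⟩ := hadm.even_l
    have := even_dvd _ (dvd_of_eq L (r.val + r.val) (by rw [hr]; simp))
    omega
  have h4 : (n : ℤ) ∣ 4 * (K - 1) := by
    have := dvd_of_eq 4 (4 * K) (by push_cast; exact h4k.symm)
    rwa [show 4 * (K - 1) = 4 * K - 4 by ring]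
  have hnd : ¬ (n : ℤ) ∣ 2 * (K - 1) := by
    intro h
    apply hadm.two_k.1
    have := (ZMod.intCast_eq_intCast_iff_dvd_sub 2 (2 * K) n).2 (by convert h using 1; ring)
    push_cast at this
    exact this.symm
  have hlat : LatticeData m n K L :=
    ⟨hadm.four_le, by omega, hm2, hn2, hKodd, hLeven⟩
  have hne : n ≠ 16 := by
    rintro rfl
    exact h2 (hasTenCycleType2_of_eq_sixteen hlat (by omega))
  obtain ⟨N, E, hs, hE⟩ := exists_stepData hn hne hKodd hn2 hK0 hKn h4 hnd
  obtain ⟨m₀, hm⟩ : ∃ m₀ : ℤ, (m : ℤ) = 2 * m₀ := ⟨m / 2, by omega⟩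
  obtain ⟨η, hη⟩ := hrot
  obtain ⟨n₀, p, hN, hn₀, hp, hA, hdvd⟩ := exists_parameters
    ⟨hlat, hs, noWrap_of_not_type3 hlat hs h3⟩ hm hK0 hL0 hη
  have hK : K = 1 + n₀ * m * E := by rw [hs.K_eq, hN]
  obtain ⟨om, on, ⟨d, hd⟩, hL⟩ := final_arithmetic hm hp hA hdvd hK
  have hnn : (n : ℤ) = 4 * n₀ * m := by rw [hs.n_eq, hN]; ring
  have hm4 := hadm.four_le
  have m3 : 3 ≤ m₀ := by have := Int.odd_iff.1 om; omega
  have omn : (m₀ * n₀) % 2 = 1 := Int.odd_iff.1 (om.mul on)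
  have on' := Int.odd_iff.1 on
  have om' := Int.odd_iff.1 om
  -- Here `c = L'/m` is reduced modulo `4n₀`, which is harmless as `n = 4n₀m`. Modulo `n₀` it is `2p
  -- - 1`, and `(2p - 1)² + 3 = 4(p² - p + 1)`.
  have finish : ∀ (c j L' : ℤ), c = 2 * p - 1 + n₀ * j → 4 ∣ c + m₀ * n₀ - 1 → L' = m * c →
      ∃ ℓ₀ : ℤ, Even ℓ₀ ∧ 0 ≤ ℓ₀ ∧ ℓ₀ < 4 * n₀ ∧ 4 ∣ ℓ₀ + m₀ * n₀ - 1 ∧ n₀ ∣ ℓ₀ ^ 2 + 3 ∧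
        (L' : ZMod n) = ((ℓ₀ * m : ℤ) : ZMod n) := by
    intro c j L' hc h4c hL'
    have hq := Int.emod_add_mul_ediv c (4 * n₀)
    have h0 := Int.emod_nonneg c (show 4 * n₀ ≠ 0 by omega)
    have h1 := Int.emod_lt_of_pos c (show 0 < 4 * n₀ by omega)
    generalize c % (4 * n₀) = ℓ₀ at hq h0 h1
    generalize c / (4 * n₀) = q at hq
    have e4 : 4 * n₀ * q = 4 * (n₀ * q) := by ring
    have h4' : 4 ∣ ℓ₀ + m₀ * n₀ - 1 := by omega
    refine ⟨ℓ₀, Int.even_iff.2 (by omega), h0, h1, h4', ?_, ?_⟩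
    · have hl : ℓ₀ = 2 * p - 1 + n₀ * (j - 4 * q) := by linear_combination hq + hc
      refine ⟨4 * d + 2 * (2 * p - 1) * (j - 4 * q) + n₀ * (j - 4 * q) ^ 2, ?_⟩
      rw [hl]; linear_combination 4 * hd
    · rw [ZMod.intCast_eq_intCast_iff_dvd_sub]
      exact ⟨-q, by rw [hL', hnn]; linear_combination (m : ℤ) * hq⟩
  rcases hE with rfl | rfl
  · obtain ⟨ℓ₀, a1, a2, a3, a4, a5, a6⟩ := finish (2 * p - 1 - 1 * (m₀ * n₀)) (-m₀) L
      (by ring) (by omega) hL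
    exact ⟨K, L, .refl, ⟨SimpleGraph.Iso.refl⟩, m₀, n₀, ℓ₀, om, on, a1, m3, hn₀, a2, a3, a4, a5,
      hm, hnn, by rw [hK]; push_cast; ring, a6⟩
  -- For `E = 3`, adding `n/2 = 2n₀m` turns `K` into `1 + 5n₀m ≡ 1 + n₀m` and adds `2n₀` to `L/m`.
  -- The congruence modulo 4 then uses that `m₀` is odd.
  · have hH : ((n / 2 : ℕ) : ℤ) = 2 * n₀ * m := by
      have e : 4 * n₀ * (m : ℤ) = 2 * (2 * n₀ * m) := by ring
      omega
    have hcast : ((n / 2 : ℕ) : ZMod n) = ((2 * n₀ * m : ℤ) : ZMod n) := by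
      rw [← hH, Int.cast_natCast]
    have hH2 : (2 * n₀ * (m : ℤ)) % 2 = 0 := by rw [mul_assoc]; omega
    obtain ⟨ℓ₀, a1, a2, a3, a4, a5, a6⟩ := finish (2 * p - 1 - 3 * (m₀ * n₀) + 2 * n₀)
      (2 - 3 * m₀) (L + 2 * n₀ * m) (by ring) (by omega) (by rw [hL]; ring)
    refine ⟨((K + 2 * n₀ * m : ℤ) : ZMod n), ((L + 2 * n₀ * m : ℤ) : ZMod n), ?_,
      nonempty_iso_shift hlat (by rw [hnn]; ring) hH2 hm om',
      m₀, n₀, ℓ₀, om, on, a1, m3, hn₀, a2, a3, a4, a5, hm, hnn, ?_, a6⟩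
    · have := Move.shift_both (m := m) (n := n) K L
        (by have : (4 : ℤ) ∣ n := ⟨N, hs.n_eq⟩
            exact_mod_cast this) (by omega)
      rw [hcast] at this
      rw [Int.cast_add K, Int.cast_add L]
      exact .single this
    · rw [ZMod.intCast_eq_intCast_iff_dvd_sub]
      exact ⟨-1, by rw [hK, hnn]; ring⟩
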